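/- Let $M$ be an oriented 3-dimensional and $N$ an oriented 2-dimensional smooth Riemannian manifold, and let $\phi:M\to N$ be a Riemannian submersion, i.e. a smooth map whose differential $\phi_*$ is at every point surjective and isometric on the orthogonal complement of its kernel. Let $vol_N$ be the volume form of $N$ and put $\nu=*\phi^*(vol_N)$, a one-form on $M$, where $*$ is the Hodge star of $M$. Let $\Psi_N$ be a spinor bundle on $N$: a complex vector bundle of rank 2 with a smooth Hermitian inner product and a Clifford multiplication $\sigma_N$, i.e. a smooth, fibrewise real-linear bundle map from $T^*N$ to the trace-free Hermitian endomorphisms of $\Psi_N$ such that $\tfrac12\mathrm{Tr}[\sigma_N(\alpha)\sigma_N(\beta)]=(\alpha,\beta)$ for all $\alpha,\beta$. Let $\nabla^N$ be a $Spin^c$ connection on $\Psi_N$: a smooth connection with $$X(\xi,\eta)=(\nabla^N_X\xi,\eta)+(\xi,\nabla^N_X\eta),\qquad [\nabla^N_X,\sigma_N(\alpha)]=\sigma_N(\nabla_X\alpha)$$ for all tangent vectors $X$, sections $\xi,\eta$ of $\Psi_N$ and one-forms $\alpha$ on $N$, where $\nabla_X\alpha$ is the Levi-Civita connection acting on one-forms.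 Let $\Psi_M=\phi^*(\Psi_N)$ be the induced bundle, with the Clifford multiplication $\sigma_M$ determined by $$\sigma_M(\phi^*\omega)=\sigma_N(\omega)\circ\phi,\qquad \sigma_M(\nu)=-\left(i\,\sigma_N(f^1)\sigma_N(f^2)\right)\circ\phi$$ for one-forms $\omega$ on $N$ and oriented orthonormal frames $f^1,f^2$ of $T^*N$, and with the connection $$\nabla^M_X=\phi^*(\nabla^N)_X-\tfrac12\sigma_M(\nu)\sigma_M(\nabla_X\nu)-\tfrac i4\,\nu(X)\,(\nu,*d\nu)\,\sigma_M(\nu),$$ where $\phi^*(\nabla^N)$ is the induced connection, i.e. the unique connection on $\phi^*(\Psi_N)$ with $\phi^*(\nabla^N)_X(\xi\circ\phi)=\nabla^N_{\phi_*X}\xi$ for all sections $\xi$ of $\Psi_N$, and $\nabla_X\nu$ is the Levi-Civita connection of $M$ acting on $\nu$. Let $\mathcal D_N$ and $\mathcal D_M$ be the corresponding Dirac operators: $\mathcal D\xi=-i\sum_j\sigma(e^j)\nabla_{e_j}\xi$ for an orthonormal basis $\{e_j\}$ of tangent vectors with dual basis $\{e^j\}$. Then for every smooth section $\xi$ of $\Psi_N$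 $$\mathcal D_M(\xi\circ\phi)=(\mathcal D_N\xi)\circ\phi+\tfrac12\,\sigma_M\!\left(*d\nu-\tfrac12(\nu,*d\nu)\,\nu\right)\sigma_M(\nu)\,\xi\circ\phi .$$ -/

import Mathlib

open Bundle Manifold ContDiff Topology

namespace SpinSubmersion

noncomputable section

section LinearAlgebra

variable {V W : Type*} [NormedAddCommGroup V] [InnerProductSpace ℝ V] [FiniteDimensional ℝ V]
  [NormedAddCommGroup W] [InnerProductSpace ℝ W] [FiniteDimensional ℝ W]

/-- The inner product of two covectors. -/
def coInner (α β : V →L[ℝ] ℝ) : ℝ :=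
  inner ℝ ((InnerProductSpace.toDual ℝ V).symm α) ((InnerProductSpace.toDual ℝ V).symm β)

/-- The Hodge star of a two-form on an oriented three-dimensional inner product space:
`*(e⁰ ∧ e¹) = e²` and cyclically, for a positively oriented orthonormal basis. -/
def hodgeStar [Fact (Module.finrank ℝ V = 3)] (o : Orientation ℝ V (Fin 3))
    (β : V →ₗ[ℝ] V →ₗ[ℝ] ℝ) : V →L[ℝ] ℝ :=
  let e := o.finOrthonormalBasis (by norm_num) Fact.out
  β (e 0) (e 1) • innerSL ℝ (e 2) + β (e 1) (e 2) • innerSL ℝ (e 0)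
    + β (e 2) (e 0) • innerSL ℝ (e 1)

variable {S : Type*} [NormedAddCommGroup S] [InnerProductSpace ℂ S]

/-- The lift of a Clifford multiplication `σ` by covectors on the oriented plane `W` along a
surjective partial isometry `A : V → W`, where the unit covector `ν` spans the orthogonal complement
of the pulled back covectors. The adjoint of `A` is the horizontal lift, so that every covector on
`V` is `α = (α ∘ A†) ∘ A + (α, ν) ν`, and the lift is determined by `ω ∘ A ↦ σ(ω)` and
`ν ↦ -i σ(f⁰) σ(f¹)`, for a positively oriented orthonormal basis `f⁰, f¹` of `W*`. -/
def liftClifford [Fact (Module.finrank ℝ W = 2)] (A : V →L[ℝ] W) (o : Orientation ℝ W (Fin 2))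
    (ν : V →L[ℝ] ℝ) (σ : (W →L[ℝ] ℝ) →ₗ[ℝ] Module.End ℂ S) :
    (V →L[ℝ] ℝ) →ₗ[ℝ] Module.End ℂ S where
  toFun α :=
    let f := o.finOrthonormalBasis (by norm_num) Fact.out
    σ (α.comp (ContinuousLinearMap.adjoint A)) +
      ((coInner α ν : ℝ) : ℂ) • (-Complex.I • (σ (innerSL ℝ (f 0)) * σ (innerSL ℝ (f 1))))
  map_add' α β := by
    simp only [coInner, ContinuousLinearMap.add_comp, map_add, inner_add_left, Complex.ofReal_add,
      add_smul]
    abel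
  map_smul' c α := by
    have h : coInner (c • α) ν = c * coInner α ν := by
      simp [coInner, real_inner_smul_left]
    simp only [ContinuousLinearMap.smul_comp, map_smul, h, Complex.ofReal_mul, mul_smul,
      RingHom.id_apply, smul_add, Complex.coe_smul]

/-- The correction `ψ, X ↦ -½ σ(ν) σ(∇_X ν) ψ - (i/4) ν(X) κ σ(ν) ψ`. -/
def spinCorrection [FiniteDimensional ℝ S] (σ : (V →L[ℝ] ℝ) →ₗ[ℝ] Module.End ℂ S) (ν : V →L[ℝ] ℝ)
    (Dν : V →L[ℝ] V →L[ℝ] ℝ) (κ : ℝ) : S →L[ℝ] V →L[ℝ] S :=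
  (LinearMap.mk₂ ℝ (fun ψ X ↦ -(1 / 2 : ℂ) • σ ν (σ (Dν X) ψ)
      - (Complex.I / 4 * (ν X : ℂ) * (κ : ℂ)) • σ ν ψ)
    (fun ψ ψ' X ↦ by simp only [map_add, smul_add]; abel)
    (fun c ψ X ↦ by
      simp only [← Complex.coe_smul, map_smul, smul_sub, smul_comm (c : ℂ)])
    (fun ψ X X' ↦ by
      simp only [map_add, LinearMap.add_apply, smul_add, Complex.ofReal_add, mul_add, add_mul,
        add_smul]
      abel)
    (fun c ψ X ↦ by
      simp only [map_smul, LinearMap.smul_apply, smul_eq_mul, Complex.ofReal_mul, smul_sub,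
        ← Complex.coe_smul, smul_smul]
      congr 2 <;> ring)).toContinuousBilinearMap

end LinearAlgebra

section Tangent

variable {E : Type*} [NormedAddCommGroup E] [NormedSpace ℝ E]
  {H : Type*} [TopologicalSpace H] {I : ModelWithCorners ℝ E H}
  {M : Type*} [TopologicalSpace M] [ChartedSpace H M]

instance [FiniteDimensional ℝ E] (x : M) : FiniteDimensional ℝ (TangentSpace I x) :=
  inferInstanceAs (FiniteDimensional ℝ E)

instance (n : ℕ) {M : Type*} [TopologicalSpace M] [ChartedSpace (EuclideanSpace ℝ (Fin n)) M]
    (x : M) : Fact (Module.finrank ℝ (TangentSpace (𝓡 n) x) = n) :=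
  ⟨(finrank_euclideanSpace_fin : Module.finrank ℝ (EuclideanSpace ℝ (Fin n)) = n)⟩

instance [IsManifold I 1 M] [RiemannianBundle (fun x : M ↦ TangentSpace I x)]
    [h : IsContMDiffRiemannianBundle I ∞ E (fun x : M ↦ TangentSpace I x)] :
    IsContMDiffRiemannianBundle I 1 E (fun x : M ↦ TangentSpace I x) :=
  h.of_le (by simp)

/-- The one-form `α` is differentiable at `x`. -/
def OneFormDiffAt [IsManifold I 1 M] (α : Π x : M, TangentSpace I x →L[ℝ] ℝ) (x : M) : Prop :=
  MDifferentiableAt I (I.prod 𝓘(ℝ, E →L[ℝ] ℝ))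
    (fun y ↦ (TotalSpace.mk' (E →L[ℝ] ℝ) y (α y) :
      TotalSpace (E →L[ℝ] ℝ) (fun y : M ↦ TangentSpace I y →L[ℝ] Bundle.Trivial M ℝ y))) x

theorem OneFormDiffAt.apply [IsManifold I 1 M] {α : Π x : M, TangentSpace I x →L[ℝ] ℝ} {x : M}
    (hα : OneFormDiffAt α x) {X : Π x : M, TangentSpace I x} (hX : MDiffAt (T% X) x) :
    MDiffAt (fun y ↦ α y (X y)) x := by
  have : MDifferentiableAt I (I.prod 𝓘(ℝ))
      (fun m ↦ TotalSpace.mk' ℝ (E := Bundle.Trivial M ℝ) m (α m (X m))) x := by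
    apply MDifferentiableAt.clm_bundle_apply (F₁ := E)
    · exact hα
    · exact hX
  simp only [mdifferentiableAt_totalSpace] at this
  exact this.2


section ext
variable [FiniteDimensional ℝ E] [IsManifold I 2 M]

/-- The expression `X(α(Y)) - Y(α(X)) - α([X, Y])` at `x`, for vector fields `X`, `Y`. -/
def extDerivAux (α : Π x : M, TangentSpace I x →L[ℝ] ℝ) (x : M)
    (X Y : Π x : M, TangentSpace I x) : ℝ :=
  d% (fun y ↦ α y (Y y)) x (X x) - d% (fun y ↦ α y (X y)) x (Y x)
    - α x (VectorField.mlieBracket I X Y x)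

theorem extDerivAux_swap (α : Π x : M, TangentSpace I x →L[ℝ] ℝ) (x : M)
    (X Y : Π x : M, TangentSpace I x) : extDerivAux α x X Y = - extDerivAux α x Y X := by
  rw [extDerivAux, extDerivAux, VectorField.mlieBracket_swap_apply, map_neg]
  ring

theorem extDerivAux_tensorial_right {α : Π x : M, TangentSpace I x →L[ℝ] ℝ} {x : M}
    (hα : OneFormDiffAt α x) (X : Π x : M, TangentSpace I x)  :
    TensorialAt I E (extDerivAux α x X) x where
  smul {f Y} hf hY := by
    have : CompleteSpace E := FiniteDimensional.complete ℝ E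
    have h1 : (fun y ↦ α y ((f • Y) y)) = fun y ↦ f y * α y (Y y) := by
      ext y; simp
    have h2 := mvfderiv_mul (I := I) hf (hα.apply hY)
    have h3 := VectorField.mlieBracket_smul_right (V := X) hf hY
    rw [extDerivAux, extDerivAux, h1, h3]
    erw [h2]
    simp
    ring
  add {Y Y'} hY hY' := by
    have : CompleteSpace E := FiniteDimensional.complete ℝ E
    have h1 : (fun y ↦ α y ((Y + Y') y)) = (fun y ↦ α y (Y y)) + (fun y ↦ α y (Y' y)) := by
      ext y; simp
    have h2 := mvfderiv_add (I := I) (hα.apply hY) (hα.apply hY')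
    have h3 := VectorField.mlieBracket_add_right (V := X) hY hY'
    rw [extDerivAux, extDerivAux, extDerivAux, h1, h3, h2]
    simp
    ring


theorem extDerivAux_tensorial_left {α : Π x : M, TangentSpace I x →L[ℝ] ℝ} {x : M}
    (hα : OneFormDiffAt α x) (Y : Π x : M, TangentSpace I x) :
    TensorialAt I E (extDerivAux α x · Y) x where
  smul {f X} hf hX := by
    rw [extDerivAux_swap, (extDerivAux_tensorial_right hα Y).smul hf hX, extDerivAux_swap α x X Y,
      smul_neg]
  add {X X'} hX hX' := by
    rw [extDerivAux_swap, (extDerivAux_tensorial_right hα Y).add hX hX', extDerivAux_swap α x X Y,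
      extDerivAux_swap α x X' Y, neg_add]

open Classical in
/-- The exterior derivative of a one-form that is differentiable at `x`, i.e. the two-form with
`dα(X, Y) = X(α(Y)) - Y(α(X)) - α([X, Y])` for all vector fields `X`, `Y`. -/
def oneFormExtDeriv (α : Π x : M, TangentSpace I x →L[ℝ] ℝ) (x : M) :
    TangentSpace I x →L[ℝ] TangentSpace I x →L[ℝ] ℝ :=
  if hα : OneFormDiffAt α x then
    TensorialAt.mkHom₂ (extDerivAux α x) x
      (fun Y _ ↦ extDerivAux_tensorial_left hα Y) (fun X _ ↦ extDerivAux_tensorial_right hα X)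
  else 0

theorem oneFormExtDeriv_apply {α : Π x : M, TangentSpace I x →L[ℝ] ℝ} {x : M}
    (hα : OneFormDiffAt α x) {X Y : Π x : M, TangentSpace I x}
    (hX : MDiffAt (T% X) x) (hY : MDiffAt (T% Y) x) :
    oneFormExtDeriv α x (X x) (Y x) =
      d% (fun y ↦ α y (Y y)) x (X x) - d% (fun y ↦ α y (X y)) x (Y x)
        - α x (VectorField.mlieBracket I X Y x) := by
  rw [oneFormExtDeriv, dif_pos hα]
  exact TensorialAt.mkHom₂_apply _ _ hX hY

theorem dualConnection_tensorial_right
    (D : CovariantDerivative I E (TangentSpace I : M → Type _))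
    {α : Π x : M, TangentSpace I x →L[ℝ] ℝ} {x : M} (hα : OneFormDiffAt α x)
    (X : Π x : M, TangentSpace I x) :
    TensorialAt I E (fun Y ↦ d% (fun y ↦ α y (Y y)) x (X x) - α x (D Y x (X x))) x where
  smul {f Y} hf hY := by
    have h1 : (fun y ↦ α y ((f • Y) y)) = fun y ↦ f y * α y (Y y) := by
      ext y; simp
    have h2 := mvfderiv_mul (I := I) hf (hα.apply hY)
    have h3 := D.isCovariantDerivativeOn.leibniz hY hf (Set.mem_univ x)
    rw [h1, h3]
    erw [h2]
    simp
    ring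
  add {Y Y'} hY hY' := by
    have h1 : (fun y ↦ α y ((Y + Y') y)) = (fun y ↦ α y (Y y)) + (fun y ↦ α y (Y' y)) := by
      ext y; simp
    have h2 := mvfderiv_add (I := I) (hα.apply hY) (hα.apply hY')
    have h3 := D.isCovariantDerivativeOn.add hY hY' (Set.mem_univ x)
    rw [h1, h2, h3]
    simp
    ring

theorem dualConnection_tensorial_left
    (D : CovariantDerivative I E (TangentSpace I : M → Type _))
    (α : Π x : M, TangentSpace I x →L[ℝ] ℝ) (x : M) (Y : Π x : M, TangentSpace I x) :
    TensorialAt I E (fun X ↦ d% (fun y ↦ α y (Y y)) x (X x) - α x (D Y x (X x))) x where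
  smul _ _ := by simp; ring
  add _ _ := by simp; ring

open Classical in
/-- The action of a connection `D` on the tangent bundle on one-forms,
`(D_X α)(Y) = X(α(Y)) - α(D_X Y)`; `dualConnection D α x v` is `D_v α` (a covector at `x`). -/
def dualConnection (D : CovariantDerivative I E (TangentSpace I : M → Type _))
    (α : Π x : M, TangentSpace I x →L[ℝ] ℝ) (x : M) :
    TangentSpace I x →L[ℝ] TangentSpace I x →L[ℝ] ℝ :=
  if hα : OneFormDiffAt α x then
    TensorialAt.mkHom₂ (fun X Y ↦ d% (fun y ↦ α y (Y y)) x (X x) - α x (D Y x (X x))) x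
      (fun Y _ ↦ dualConnection_tensorial_left D α x Y)
      (fun X _ ↦ dualConnection_tensorial_right D hα X)
  else 0

theorem dualConnection_apply (D : CovariantDerivative I E (TangentSpace I : M → Type _))
    {α : Π x : M, TangentSpace I x →L[ℝ] ℝ} {x : M} (hα : OneFormDiffAt α x)
    {X Y : Π x : M, TangentSpace I x} (hX : MDiffAt (T% X) x) (hY : MDiffAt (T% Y) x) :
    dualConnection D α x (X x) (Y x) = d% (fun y ↦ α y (Y y)) x (X x) - α x (D Y x (X x)) := by
  rw [dualConnection, dif_pos hα]
  exact TensorialAt.mkHom₂_apply _ _ hX hY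

section LeviCivita

variable [RiemannianBundle (fun x : M ↦ TangentSpace I x)]
  [IsContMDiffRiemannianBundle I 1 E (fun x : M ↦ TangentSpace I x)]

/-- The right-hand side of the Koszul formula for `2 (∇_X Y, Z)` at `x`. -/
def koszul (X Y Z : Π x : M, TangentSpace I x) (x : M) : ℝ :=
  d% (fun y ↦ inner ℝ (Y y) (Z y)) x (X x) + d% (fun y ↦ inner ℝ (Z y) (X y)) x (Y x)
    - d% (fun y ↦ inner ℝ (X y) (Y y)) x (Z x)
    + inner ℝ (VectorField.mlieBracket I X Y x) (Z x)
    - inner ℝ (VectorField.mlieBracket I Y Z x) (X x)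
    + inner ℝ (VectorField.mlieBracket I Z X x) (Y x)

theorem inner_diffAt {X Y : Π x : M, TangentSpace I x} {x : M}
    (hX : MDiffAt (T% X) x) (hY : MDiffAt (T% Y) x) :
    MDiffAt (fun y ↦ inner ℝ (X y) (Y y)) x :=
  MDifferentiableAt.inner_bundle hX hY

theorem deriv_inner_smul_left {f : M → ℝ} {X Y : Π x : M, TangentSpace I x} {x : M}
    (hf : MDiffAt f x) (hX : MDiffAt (T% X) x) (hY : MDiffAt (T% Y) x) (v : TangentSpace I x) :
    d% (fun y ↦ inner ℝ ((f • X) y) (Y y)) x v =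
      f x * d% (fun y ↦ inner ℝ (X y) (Y y)) x v + d% f x v * inner ℝ (X x) (Y x) := by
  have h1 : (fun y ↦ inner ℝ ((f • X) y) (Y y)) = fun y ↦ f y * inner ℝ (X y) (Y y) := by
    ext y; simp [real_inner_smul_left]
  have h2 := mvfderiv_mul (I := I) hf (inner_diffAt hX hY)
  rw [h1]
  erw [h2]
  simp
  ring

theorem deriv_inner_add_left {X X' Y : Π x : M, TangentSpace I x} {x : M}
    (hX : MDiffAt (T% X) x) (hX' : MDiffAt (T% X') x) (hY : MDiffAt (T% Y) x)
    (v : TangentSpace I x) :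
    d% (fun y ↦ inner ℝ ((X + X') y) (Y y)) x v =
      d% (fun y ↦ inner ℝ (X y) (Y y)) x v + d% (fun y ↦ inner ℝ (X' y) (Y y)) x v := by
  have h1 : (fun y ↦ inner ℝ ((X + X') y) (Y y)) =
      (fun y ↦ inner ℝ (X y) (Y y)) + fun y ↦ inner ℝ (X' y) (Y y) := by
    ext y; simp [inner_add_left]
  have h2 := mvfderiv_add (I := I) (inner_diffAt hX hY) (inner_diffAt hX' hY)
  rw [h1, h2]
  rfl

theorem deriv_inner_comm (X Y : Π x : M, TangentSpace I x) (x : M) :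
    d% (fun y ↦ inner ℝ (X y) (Y y)) x = d% (fun y ↦ inner ℝ (Y y) (X y)) x := by
  simp_rw [real_inner_comm]

theorem koszul_tensorial_left {Y Z : Π x : M, TangentSpace I x} {x : M}
    (hY : MDiffAt (T% Y) x) (hZ : MDiffAt (T% Z) x) :
    TensorialAt I E (koszul · Y Z x) x where
  smul {f X} hf hX := by
    have : CompleteSpace E := FiniteDimensional.complete ℝ E
    simp only [koszul]
    rw [deriv_inner_comm Z (f • X), deriv_inner_smul_left hf hX hY, deriv_inner_smul_left hf hX hZ,
      VectorField.mlieBracket_smul_left hf hX, VectorField.mlieBracket_smul_right hf hX,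
      deriv_inner_comm Z X]
    simp [inner_add_left, real_inner_smul_left, real_inner_smul_right]
    ring
  add {X X'} hX hX' := by
    have : CompleteSpace E := FiniteDimensional.complete ℝ E
    simp only [koszul]
    rw [deriv_inner_comm Z (X + X'), deriv_inner_add_left hX hX' hY,
      deriv_inner_add_left hX hX' hZ, VectorField.mlieBracket_add_left hX hX',
      VectorField.mlieBracket_add_right hX hX', deriv_inner_comm Z X, deriv_inner_comm Z X']
    simp [inner_add_left, inner_add_right]
    ring

theorem koszul_tensorial_right {X Y : Π x : M, TangentSpace I x} {x : M}
    (hX : MDiffAt (T% X) x) (hY : MDiffAt (T% Y) x) :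
    TensorialAt I E (koszul X Y · x) x where
  smul {f Z} hf hZ := by
    have : CompleteSpace E := FiniteDimensional.complete ℝ E
    simp only [koszul]
    rw [deriv_inner_comm Y (f • Z), deriv_inner_smul_left hf hZ hX, deriv_inner_smul_left hf hZ hY,
      VectorField.mlieBracket_smul_left hf hZ, VectorField.mlieBracket_smul_right hf hZ,
      deriv_inner_comm Y Z]
    simp [inner_add_left, real_inner_smul_left, real_inner_smul_right]
    ring
  add {Z Z'} hZ hZ' := by
    have : CompleteSpace E := FiniteDimensional.complete ℝ E
    simp only [koszul]
    rw [deriv_inner_comm Y (Z + Z'), deriv_inner_add_left hZ hZ' hX,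
      deriv_inner_add_left hZ hZ' hY, VectorField.mlieBracket_add_left hZ hZ',
      VectorField.mlieBracket_add_right hZ hZ', deriv_inner_comm Y Z, deriv_inner_comm Y Z']
    simp [inner_add_left, inner_add_right]
    ring

open Classical in
/-- The Koszul form `(X, Z) ↦ 2 (∇_X Y, Z)` at `x`, for a vector field `Y` differentiable at `x`. -/
def koszulForm (Y : Π x : M, TangentSpace I x) (x : M) :
    TangentSpace I x →L[ℝ] TangentSpace I x →L[ℝ] ℝ :=
  if hY : MDiffAt (T% Y) x then
    TensorialAt.mkHom₂ (fun X Z ↦ koszul X Y Z x) x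
      (fun _ hZ ↦ koszul_tensorial_left hY hZ) (fun _ hX ↦ koszul_tensorial_right hX hY)
  else 0

theorem koszulForm_apply {X Y Z : Π x : M, TangentSpace I x} {x : M}
    (hX : MDiffAt (T% X) x) (hY : MDiffAt (T% Y) x) (hZ : MDiffAt (T% Z) x) :
    koszulForm Y x (X x) (Z x) = koszul X Y Z x := by
  rw [koszulForm, dif_pos hY]
  exact TensorialAt.mkHom₂_apply _ _ hX hZ

/-- The tangent vector `∇_X Y` at `x` with `2 (∇_X Y, Z)` given by the Koszul form. -/
def leviCivitaFun (Y : Π x : M, TangentSpace I x) (x : M) :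
    TangentSpace I x →L[ℝ] TangentSpace I x :=
  (1 / 2 : ℝ) • ∑ k, ((koszulForm Y x).flip (stdOrthonormalBasis ℝ (TangentSpace I x) k)).smulRight
    (stdOrthonormalBasis ℝ (TangentSpace I x) k)

theorem inner_leviCivitaFun (Y : Π x : M, TangentSpace I x) (x : M) (v w : TangentSpace I x) :
    2 * inner ℝ (leviCivitaFun Y x v) w = koszulForm Y x v w := by
  have h := (stdOrthonormalBasis ℝ (TangentSpace I x)).sum_repr w
  conv_rhs => rw [← h]
  simp [leviCivitaFun, sum_inner, real_inner_smul_left, OrthonormalBasis.repr_apply_apply]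
  exact Finset.sum_congr rfl fun _ _ ↦ mul_comm _ _

theorem koszul_add_middle {X Y Y' Z : Π x : M, TangentSpace I x} {x : M}
    (hX : MDiffAt (T% X) x) (hY : MDiffAt (T% Y) x) (hY' : MDiffAt (T% Y') x)
    (hZ : MDiffAt (T% Z) x) :
    koszul X (Y + Y') Z x = koszul X Y Z x + koszul X Y' Z x := by
  have : CompleteSpace E := FiniteDimensional.complete ℝ E
  simp only [koszul]
  rw [deriv_inner_comm X (Y + Y'), deriv_inner_add_left hY hY' hX,
    deriv_inner_add_left hY hY' hZ, VectorField.mlieBracket_add_left hY hY',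
    VectorField.mlieBracket_add_right hY hY', deriv_inner_comm X Y, deriv_inner_comm X Y']
  simp [inner_add_left, inner_add_right]
  ring

theorem koszul_smul_middle {f : M → ℝ} {X Y Z : Π x : M, TangentSpace I x} {x : M}
    (hf : MDiffAt f x) (hX : MDiffAt (T% X) x) (hY : MDiffAt (T% Y) x)
    (hZ : MDiffAt (T% Z) x) :
    koszul X (f • Y) Z x = f x * koszul X Y Z x + 2 * (d% f x (X x) * inner ℝ (Y x) (Z x)) := by
  have : CompleteSpace E := FiniteDimensional.complete ℝ E
  simp only [koszul]
  rw [deriv_inner_comm X (f • Y), deriv_inner_smul_left hf hY hX, deriv_inner_smul_left hf hY hZ,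
    VectorField.mlieBracket_smul_left hf hY, VectorField.mlieBracket_smul_right hf hY,
    deriv_inner_comm X Y]
  simp [inner_add_left, real_inner_smul_left, real_inner_smul_right]
  ring

variable (I M) in
/-- The Levi-Civita connection, defined by the Koszul formula. -/
def leviCivita : CovariantDerivative I E (TangentSpace I : M → Type _) where
  toFun := leviCivitaFun
  isCovariantDerivativeOnUniv :=
    { add := fun {Y Y' x} hY hY' _ ↦ by
        ext v
        refine ext_inner_right ℝ fun w ↦ ?_
        have hv := FiberBundle.mdifferentiableAt_extend I E v
        have hw := FiberBundle.mdifferentiableAt_extend I E w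
        have h := koszul_add_middle hv hY hY' hw
        rw [← koszulForm_apply hv hY hw, ← koszulForm_apply hv hY' hw,
          ← koszulForm_apply hv (mdifferentiableAt_add_section hY hY') hw] at h
        simp only [FiberBundle.extend_apply_self, ← inner_leviCivitaFun] at h
        simp only [ContinuousLinearMap.add_apply, inner_add_left]
        linarith
      leibniz := fun {Y g x} hY hg _ ↦ by
        ext v
        refine ext_inner_right ℝ fun w ↦ ?_
        have hv := FiberBundle.mdifferentiableAt_extend I E v
        have hw := FiberBundle.mdifferentiableAt_extend I E w
        have h := koszul_smul_middle hg hv hY hw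
        rw [← koszulForm_apply hv hY hw,
          ← koszulForm_apply hv (hg.smul_section hY) hw] at h
        simp only [FiberBundle.extend_apply_self, ← inner_leviCivitaFun] at h
        simp only [ContinuousLinearMap.add_apply, inner_add_left, ContinuousLinearMap.smul_apply,
          ContinuousLinearMap.smulRight_apply, real_inner_smul_left]
        linarith }

theorem two_inner_leviCivita {X Y Z : Π x : M, TangentSpace I x} {x : M}
    (hX : MDiffAt (T% X) x) (hY : MDiffAt (T% Y) x) (hZ : MDiffAt (T% Z) x) :
    2 * inner ℝ (leviCivita I M Y x (X x)) (Z x) = koszul X Y Z x := by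
  rw [← koszulForm_apply hX hY hZ]
  exact inner_leviCivitaFun _ _ _ _

/-- The Levi-Civita connection is compatible with the metric. -/
theorem leviCivita_metric {X Y Z : Π x : M, TangentSpace I x} {x : M}
    (hX : MDiffAt (T% X) x) (hY : MDiffAt (T% Y) x) (hZ : MDiffAt (T% Z) x) :
    d% (fun y ↦ inner ℝ (Y y) (Z y)) x (X x) =
      inner ℝ (leviCivita I M Y x (X x)) (Z x) + inner ℝ (Y x) (leviCivita I M Z x (X x)) := by
  have h1 := two_inner_leviCivita hX hY hZ
  have h2 := two_inner_leviCivita hX hZ hY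
  rw [koszul] at h1 h2
  rw [deriv_inner_comm Z Y, deriv_inner_comm Y X, deriv_inner_comm X Z,
    VectorField.mlieBracket_swap_apply (V := X) (W := Z),
    VectorField.mlieBracket_swap_apply (V := Z) (W := Y),
    VectorField.mlieBracket_swap_apply (V := Y) (W := X)] at h2
  simp only [inner_neg_left] at h2
  rw [real_inner_comm (leviCivita I M Z x (X x)) (Y x)]
  linarith

/-- The Levi-Civita connection is torsion-free. -/
theorem leviCivita_torsion_free {X Y : Π x : M, TangentSpace I x} {x : M}
    (hX : MDiffAt (T% X) x) (hY : MDiffAt (T% Y) x) :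
    leviCivita I M Y x (X x) - leviCivita I M X x (Y x) = VectorField.mlieBracket I X Y x := by
  refine ext_inner_right ℝ fun w ↦ ?_
  have hw := FiberBundle.mdifferentiableAt_extend I E w
  have h1 := two_inner_leviCivita hX hY hw
  have h2 := two_inner_leviCivita hY hX hw
  rw [koszul] at h1 h2
  rw [deriv_inner_comm X (FiberBundle.extend E w), deriv_inner_comm (FiberBundle.extend E w) Y,
    deriv_inner_comm Y X,
    VectorField.mlieBracket_swap_apply (V := Y) (W := X),
    VectorField.mlieBracket_swap_apply (V := X) (W := FiberBundle.extend E w),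
    VectorField.mlieBracket_swap_apply (V := FiberBundle.extend E w) (W := Y)] at h2
  simp only [inner_neg_left, FiberBundle.extend_apply_self] at h1 h2
  rw [inner_sub_left]
  linarith

end LeviCivita

end ext

section Spinors

variable [RiemannianBundle (fun x : M ↦ TangentSpace I x)] [FiniteDimensional ℝ E]
  {F : Type*} [NormedAddCommGroup F] [NormedSpace ℝ F]

section Dirac

variable {V : M → Type*} [∀ x, AddCommGroup (V x)] [∀ x, Module ℝ (V x)]
  [∀ x, Module ℂ (V x)] [∀ x, TopologicalSpace (V x)] [∀ x, IsTopologicalAddGroup (V x)]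
  [∀ x, ContinuousSMul ℝ (V x)] [TopologicalSpace (TotalSpace F V)] [FiberBundle F V]

/-- The Dirac operator `D ξ = -i ∑ⱼ σ(eʲ) ∇_{eⱼ} ξ`, for a Clifford multiplication `σ` and a
connection `D`. The sum runs over an orthonormal basis `eⱼ` of the tangent space,
and `eʲ` is the dual basis. -/
def dirac (σ : Π x : M, (TangentSpace I x →L[ℝ] ℝ) → Module.End ℂ (V x))
    (D : CovariantDerivative I F V) (ξ : Π x : M, V x) (x : M) : V x :=
  -Complex.I • ∑ j, σ x (innerSL ℝ (stdOrthonormalBasis ℝ (TangentSpace I x) j))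
    (D ξ x (stdOrthonormalBasis ℝ (TangentSpace I x) j))

end Dirac

variable [IsManifold I 2 M] [IsContMDiffRiemannianBundle I 1 E (fun x : M ↦ TangentSpace I x)]
  {V : M → Type*} [∀ x, NormedAddCommGroup (V x)] [∀ x, InnerProductSpace ℂ (V x)]
  [TopologicalSpace (TotalSpace F V)] [FiberBundle F V]

/-- The Dirac operator does not depend on the orthonormal basis. -/
theorem dirac_eq_sum (σ : Π x : M, (TangentSpace I x →L[ℝ] ℝ) →ₗ[ℝ] Module.End ℂ (V x))
    (D : CovariantDerivative I F V) (ξ : Π x : M, V x) (x : M) {ι : Type*} [Fintype ι]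
    (e : OrthonormalBasis ι ℝ (TangentSpace I x)) :
    dirac (fun x α ↦ σ x α) D ξ x =
      -Complex.I • ∑ j, σ x (innerSL ℝ (e j)) (D ξ x (e j)) := by
  let f := stdOrthonormalBasis ℝ (TangentSpace I x)
  rw [dirac]
  congr 1
  have h1 : ∀ j, D ξ x (f j) = ∑ k, inner ℝ (e k) (f j) • D ξ x (e k) := fun j ↦ by
    conv_lhs => rw [← e.sum_repr (f j)]
    rw [map_sum]
    exact Finset.sum_congr rfl fun k _ ↦ by
      rw [map_smul, OrthonormalBasis.repr_apply_apply]
  have h2 : ∀ k, innerSL ℝ (e k) = ∑ j, inner ℝ (f j) (e k) • innerSL ℝ (f j) := fun k ↦ by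
    conv_lhs => rw [← f.sum_repr (e k)]
    simp [OrthonormalBasis.repr_apply_apply]
  have h3 : ∀ k, σ x (innerSL ℝ (e k)) (D ξ x (e k)) =
      ∑ j, inner ℝ (f j) (e k) • σ x (innerSL ℝ (f j)) (D ξ x (e k)) := fun k ↦ by
    rw [h2 k]
    simp
  have h4 : ∀ j, σ x (innerSL ℝ (f j)) (D ξ x (f j)) =
      ∑ k, inner ℝ (f j) (e k) • σ x (innerSL ℝ (f j)) (D ξ x (e k)) := fun j ↦ by
    rw [h1 j, map_sum]
    refine Finset.sum_congr rfl fun k _ ↦ ?_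
    rw [real_inner_comm]
    exact LinearMap.map_smul_of_tower _ _ _
  simp_rw [h3]
  rw [Finset.sum_comm]
  exact Finset.sum_congr rfl fun j _ ↦ h4 j

variable (I F) in
/-- The Hermitian inner products on the fibres of `V` vary smoothly. -/
def IsSmoothHermitian (V : M → Type*) [∀ x, NormedAddCommGroup (V x)]
    [∀ x, InnerProductSpace ℂ (V x)] [TopologicalSpace (TotalSpace F V)] [FiberBundle F V]
    [VectorBundle ℝ F V] : Prop :=
  ∀ (ξ η : Π x : M, V x) (x : M), CMDiffAt ∞ (T% ξ) x → CMDiffAt ∞ (T% η) x →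
    ContMDiffAt I 𝓘(ℝ, ℂ) ∞ (fun y ↦ inner ℂ (ξ y) (η y)) x

/-- `σ : T*M → End(V)` is a Clifford multiplication on the Hermitian vector bundle `V`: it is a
smooth bundle map, isometric onto its image, with values in the trace-free Hermitian endomorphisms,
for the inner product `(A, B) = ½ Tr(AB)` of such endomorphisms. -/
structure IsCliffordMultiplication [VectorBundle ℝ F V]
    (σ : Π x : M, (TangentSpace I x →L[ℝ] ℝ) →ₗ[ℝ] Module.End ℂ (V x)) : Prop where
  hermitian : ∀ x α (v w : V x), inner ℂ (σ x α v) w = inner ℂ v (σ x α w)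
  trace_eq_zero : ∀ x α, LinearMap.trace ℂ (V x) (σ x α) = 0
  isometry : ∀ x α β, (1 / 2 : ℂ) * LinearMap.trace ℂ (V x) (σ x α * σ x β) = (coInner α β : ℝ)
  smooth : ∀ (α : Π x : M, TangentSpace I x →L[ℝ] ℝ) (ξ : Π x : M, V x) (x : M),
    ContMDiffAt I (I.prod 𝓘(ℝ, E →L[ℝ] ℝ)) ∞
      (fun y ↦ (TotalSpace.mk' (E →L[ℝ] ℝ) y (α y) :
        TotalSpace (E →L[ℝ] ℝ) (fun y : M ↦ TangentSpace I y →L[ℝ] Bundle.Trivial M ℝ y))) x →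
    CMDiffAt ∞ (T% ξ) x → CMDiffAt ∞ (T% (fun y ↦ σ y (α y) (ξ y))) x

/-- `D` is a (smooth) `Spin^c` connection on the spinor bundle `V` with Clifford multiplication `σ`.
The first condition forces `D` to be complex linear. -/
structure IsSpincConnection [VectorBundle ℝ F V]
    (σ : Π x : M, (TangentSpace I x →L[ℝ] ℝ) →ₗ[ℝ] Module.End ℂ (V x))
    (D : CovariantDerivative I F V) : Prop where
  smooth : CovariantDerivative.ContMDiffCovariantDerivative D ∞
  metric : ∀ (ξ η : Π x : M, V x) (x : M) (X : TangentSpace I x),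
    MDiffAt (T% ξ) x → MDiffAt (T% η) x →
    d% (fun y ↦ inner ℂ (ξ y) (η y)) x X =
      inner ℂ (D ξ x X) (η x) + inner ℂ (ξ x) (D η x X)
  clifford : ∀ (α : Π x : M, TangentSpace I x →L[ℝ] ℝ) (ξ : Π x : M, V x) (x : M)
    (X : TangentSpace I x), OneFormDiffAt α x → MDiffAt (T% ξ) x →
    D (fun y ↦ σ y (α y) (ξ y)) x X - σ x (α x) (D ξ x X) =
      σ x (dualConnection (leviCivita I M) α x X) (ξ x)

end Spinors

end Tangent

section Pullback

/-! The fibre `V (φ x)` of the induced bundle `φ *ᵖ V` carries the algebraic structure of `V`. -/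

variable {M N : Type*} (φ : M → N) (V : N → Type*) [∀ x, NormedAddCommGroup (V x)]

instance (x : M) : AddCommGroup ((φ *ᵖ V) x) := inferInstanceAs (AddCommGroup (V (φ x)))

instance (x : M) : IsTopologicalAddGroup ((φ *ᵖ V) x) :=
  inferInstanceAs (IsTopologicalAddGroup (V (φ x)))

instance [∀ x, NormedSpace ℝ (V x)] (x : M) : ContinuousSMul ℝ ((φ *ᵖ V) x) :=
  inferInstanceAs (ContinuousSMul ℝ (V (φ x)))

end Pullback

section InducedConnection

variable {E : Type*} [NormedAddCommGroup E] [NormedSpace ℝ E]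
  {H : Type*} [TopologicalSpace H] {I : ModelWithCorners ℝ E H}
  {M : Type*} [TopologicalSpace M] [ChartedSpace H M]
  {E' : Type*} [NormedAddCommGroup E'] [NormedSpace ℝ E']
  {H' : Type*} [TopologicalSpace H'] {I' : ModelWithCorners ℝ E' H'}
  {N : Type*} [TopologicalSpace N] [ChartedSpace H' N]
  {F : Type*} [NormedAddCommGroup F] [NormedSpace ℝ F]
  {V : N → Type*} [∀ x, NormedAddCommGroup (V x)] [∀ x, NormedSpace ℝ (V x)]
  [TopologicalSpace (TotalSpace F V)] [FiberBundle F V] [VectorBundle ℝ F V]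

/-- The local section of `V` near `x` that is constant, equal to `w`, in the trivialization
of `V` at `x`. -/
def constSection (V : N → Type*) [∀ x, NormedAddCommGroup (V x)] [∀ x, NormedSpace ℝ (V x)]
    [TopologicalSpace (TotalSpace F V)] [FiberBundle F V] [VectorBundle ℝ F V]
    (x : N) (w : F) (y : N) : V y :=
  (trivializationAt F V x).symmL ℝ y w

theorem constSection_add (x : N) (w w' : F) :
    constSection V x (w + w') = constSection V x w + constSection V x w' :=
  funext fun y ↦ map_add ((trivializationAt F V x).symmL ℝ y) w w'

theorem constSection_smul (x : N) (c : ℝ) (w : F) :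
    constSection V x (c • w) = c • constSection V x w :=
  funext fun y ↦ map_smul ((trivializationAt F V x).symmL ℝ y) c w

theorem read_constSection {x y : N} (hy : y ∈ (trivializationAt F V x).baseSet) (w : F) :
    (trivializationAt F V x ⟨y, constSection V x w y⟩).2 = w := by
  rw [constSection, Trivialization.symmL_apply _ hy, Trivialization.apply_mk_symm _ hy]

theorem constSection_diffAt (x : N) (w : F) :
    MDiffAt (T% (constSection V x w)) x := by
  rw [mdifferentiableAt_totalSpace]
  refine ⟨mdifferentiableAt_id, ?_⟩
  have h : (fun y ↦ (trivializationAt F V x ⟨y, constSection V x w y⟩).2) =ᶠ[𝓝 x] fun _ ↦ w := by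
    filter_upwards [(trivializationAt F V x).open_baseSet.mem_nhds
      (FiberBundle.mem_baseSet_trivializationAt' x)] with y hy
    exact read_constSection hy w
  exact (mdifferentiableAt_const (c := w)).congr_of_eventuallyEq h

/-- A section `η` of the induced bundle, read in the trivialization of `V` at `φ x`. -/
def readSection (φ : M → N) (η : Π x : M, (φ *ᵖ V) x) (x : M) : M → F :=
  fun y ↦ (trivializationAt F V (φ x) ⟨φ y, η y⟩).2

theorem readSection_diffAt {φ : C^∞⟮I, M; I', N⟯} {η : Π x : M, (φ *ᵖ V) x} {x : M}
    (hη : MDifferentiableAt I (I.prod 𝓘(ℝ, F)) (fun y ↦ TotalSpace.mk' F y (η y)) x) :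
    MDiffAt (readSection (F := F) φ η x) x := by
  rw [mdifferentiableAt_totalSpace] at hη
  exact hη.2

theorem eventually_mem_baseSet (φ : C^∞⟮I, M; I', N⟯) (x : M) :
    ∀ᶠ y in 𝓝 x, φ y ∈ (trivializationAt F V (φ x)).baseSet :=
  φ.contMDiff.continuous.continuousAt.eventually_mem
    ((trivializationAt F V (φ x)).open_baseSet.mem_nhds
      (FiberBundle.mem_baseSet_trivializationAt' (φ x)))

theorem readSection_add (φ : C^∞⟮I, M; I', N⟯) (η η' : Π x : M, (φ *ᵖ V) x) (x : M) :
    readSection (F := F) φ (η + η') x =ᶠ[𝓝 x] readSection φ η x + readSection φ η' x := by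
  filter_upwards [eventually_mem_baseSet (F := F) (V := V) φ x] with y hy
  exact ((trivializationAt F V (φ x)).linear ℝ hy).map_add (η y) (η' y)

theorem readSection_smul (φ : C^∞⟮I, M; I', N⟯) (g : M → ℝ) (η : Π x : M, (φ *ᵖ V) x) (x : M) :
    readSection (F := F) φ (g • η) x =ᶠ[𝓝 x] g • readSection φ η x := by
  filter_upwards [eventually_mem_baseSet (F := F) (V := V) φ x] with y hy
  exact ((trivializationAt F V (φ x)).linear ℝ hy).map_smul (g y) (η y)

theorem symm_readSection (φ : M → N) (η : Π x : M, (φ *ᵖ V) x) (x : M) :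
    (trivializationAt F V (φ x)).symmL ℝ (φ x) (readSection φ η x x) = η x := by
  rw [Trivialization.symmL_apply _ (FiberBundle.mem_baseSet_trivializationAt' (φ x))]
  exact (trivializationAt F V (φ x)).symm_apply_apply_mk
    (FiberBundle.mem_baseSet_trivializationAt' (φ x)) (η x)

theorem mvfderiv_congr {f g : M → F} {x : M} (h : f =ᶠ[𝓝 x] g) : d% f x = d% g x := by
  ext v
  simp only [mvfderiv]
  rw [h.mfderiv_eq]
  rfl

/-- The induced connection on `φ *ᵖ V`. In the trivialization of `V` at `φ x`, a section `η` of the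
induced bundle has coefficients `u : M → F` with respect to sections `s` of `V` that are constant
in this trivialization, and `(φ^* D)_X η = (d_X u) s + u (D_{φ_* X} s)` at `x`. -/
def inducedConnection (φ : C^∞⟮I, M; I', N⟯) (D : CovariantDerivative I' F V) :
    CovariantDerivative I F (φ *ᵖ V) where
  toFun η x :=
    ((trivializationAt F V (φ x)).symmL ℝ (φ x)).comp (mvfderiv I (readSection (F := F) φ η x) x) +
      (D (constSection V (φ x) (readSection (F := F) φ η x x)) (φ x)).comp (mfderiv I I' φ x)
  isCovariantDerivativeOnUniv :=
    { add := fun {η η' x} hη hη' _ ↦ by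
        have h1 := mvfderiv_congr (I := I) (readSection_add (F := F) φ η η' x)
        rw [mvfderiv_add (readSection_diffAt hη) (readSection_diffAt hη')] at h1
        have h2 := (readSection_add (F := F) φ η η' x).eq_of_nhds
        have h3 := D.isCovariantDerivativeOn.add
          (constSection_diffAt (I' := I') (V := V) (φ x) (readSection (F := F) φ η x x))
          (constSection_diffAt (I' := I') (V := V) (φ x) (readSection (F := F) φ η' x x))
          (Set.mem_univ (φ x))
        rw [h1, h2, Pi.add_apply, constSection_add, h3, ContinuousLinearMap.comp_add,
          ContinuousLinearMap.add_comp]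
        exact add_add_add_comm _ _ _ _
      leibniz := fun {η g x} hη hg _ ↦ by
        have h1 := mvfderiv_congr (I := I) (readSection_smul (F := F) φ g η x)
        rw [mvfderiv_smul hg (readSection_diffAt hη)] at h1
        have h2 := (readSection_smul (F := F) φ g η x).eq_of_nhds
        have h3 := D.isCovariantDerivativeOn.smul_const (g x)
          (constSection_diffAt (I' := I') (V := V) (φ x) (readSection (F := F) φ η x x))
          (Set.mem_univ (φ x))
        have h4 := symm_readSection (F := F) φ η x
        rw [h1, h2, Pi.smul_apply', constSection_smul, h3, ContinuousLinearMap.comp_add,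
          ContinuousLinearMap.comp_smul, ContinuousLinearMap.smul_comp]
        have h5 : ((trivializationAt F V (φ x)).symmL ℝ (φ x)).comp
            ((mvfderiv I g x).smulRight (readSection (F := F) φ η x x)) =
            (mvfderiv I g x).smulRight (η x : V (φ x)) := by
          ext v
          exact (map_smul ((trivializationAt F V (φ x)).symmL ℝ (φ x)) _ _).trans (by rw [h4]; rfl)
        have h6 : ∀ (A B C : TangentSpace I x →L[ℝ] V (φ x)) (c : ℝ),
            c • A + B + c • C = c • (A + C) + B := fun A B C c ↦ by rw [smul_add]; abel
        exact (h6 _ _ _ _).trans (congrArg (_ + ·) h5) }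

/-- The chain rule, which characterizes the induced connection. -/
theorem inducedConnection_comp [FiniteDimensional ℝ F] [ContMDiffVectorBundle 1 F V I']
    (φ : C^∞⟮I, M; I', N⟯)
    (D : CovariantDerivative I' F V) {ξ : Π x : N, V x} {x : M}
    (hξ : MDiffAt (T% ξ) (φ x)) (v : TangentSpace I x) :
    inducedConnection φ D (fun y ↦ ξ (φ y)) x v = D ξ (φ x) (mfderiv I I' φ x v) := by
  set e := trivializationAt F V (φ x) with he
  let u : (Π y : N, V y) → N → F := fun ζ y ↦ (e ⟨y, ζ y⟩).2
  have hbase := FiberBundle.mem_baseSet_trivializationAt' (F := F) (E := V) (φ x)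
  have hu : ∀ ζ : Π y : N, V y, MDiffAt (T% ζ) (φ x) → MDiffAt (u ζ) (φ x) := fun ζ hζ ↦ by
    rw [mdifferentiableAt_totalSpace] at hζ
    exact hζ.2
  have hmem : ∀ᶠ y in 𝓝 (φ x), y ∈ e.baseSet := e.open_baseSet.mem_nhds hbase
  have hsymm : ∀ ζ : Π y : N, V y, e.symmL ℝ (φ x) (u ζ (φ x)) = ζ (φ x) := fun ζ ↦ by
    rw [Trivialization.symmL_apply _ hbase]
    exact e.symm_apply_apply_mk hbase (ζ (φ x))
  let w : TangentSpace I' (φ x) := mfderiv I I' φ x v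
  have hT : TensorialAt I' F
      (fun ζ : Π y : N, V y ↦ D ζ (φ x) w - e.symmL ℝ (φ x) (d% (u ζ) (φ x) w)) (φ x) :=
    { smul := fun {g ζ} hg hζ ↦ by
        have h1 : u (g • ζ) =ᶠ[𝓝 (φ x)] g • u ζ := by
          filter_upwards [hmem] with y hy
          exact (e.linear ℝ hy).map_smul (g y) (ζ y)
        have h2 := mvfderiv_congr (I := I') h1
        rw [mvfderiv_smul hg (hu ζ hζ)] at h2
        have h3 := D.isCovariantDerivativeOn.leibniz hζ hg (Set.mem_univ (φ x))
        have h4 := hsymm ζ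
        rw [h2, h3]
        simp only [_root_.add_apply,
          _root_.smul_apply, ContinuousLinearMap.smulRight_apply, map_add, map_smul,
          h4, smul_sub]
        abel
      add := fun {ζ ζ'} hζ hζ' ↦ by
        have h1 : u (ζ + ζ') =ᶠ[𝓝 (φ x)] u ζ + u ζ' := by
          filter_upwards [hmem] with y hy
          exact (e.linear ℝ hy).map_add (ζ y) (ζ' y)
        have h2 := mvfderiv_congr (I := I') h1
        rw [mvfderiv_add (hu ζ hζ) (hu ζ' hζ')] at h2
        have h3 := D.isCovariantDerivativeOn.add hζ hζ' (Set.mem_univ (φ x))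
        rw [h2, h3]
        simp only [_root_.add_apply, map_add]
        abel }
  have hext := constSection_diffAt (I' := I') (V := V) (φ x) (u ξ (φ x))
  have key := hT.pointwise hξ hext (hsymm ξ).symm
  have hconst : u (constSection V (φ x) (u ξ (φ x))) =ᶠ[𝓝 (φ x)] fun _ ↦ u ξ (φ x) := by
    filter_upwards [hmem] with y hy
    exact read_constSection hy _
  have h0 : d% (u (constSection V (φ x) (u ξ (φ x)))) (φ x) w = 0 := by
    rw [mvfderiv_congr hconst, mvfderiv_const]
    rfl
  have hφ : MDifferentiableAt I I' φ x := φ.contMDiff.mdifferentiable (by simp) x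
  have hcomp : mvfderiv I (readSection (F := F) φ (fun y ↦ ξ (φ y)) x) x v
      = d% (u ξ) (φ x) w :=
    mfderiv_comp_apply x (hu ξ hξ) hφ v
  simp only [h0, map_zero, sub_zero] at key
  rw [sub_eq_iff_eq_add] at key
  change e.symmL ℝ (φ x) (mvfderiv I (readSection (F := F) φ (fun y ↦ ξ (φ y)) x) x v) +
    D (constSection V (φ x) (u ξ (φ x))) (φ x) w = D ξ (φ x) w
  rw [hcomp, key, add_comm]

end InducedConnection

section Submersion

variable {M : Type*} [TopologicalSpace M] [ChartedSpace (EuclideanSpace ℝ (Fin 3)) M]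
  [RiemannianBundle (fun x : M ↦ TangentSpace (𝓡 3) x)]
  {N : Type*} [TopologicalSpace N] [ChartedSpace (EuclideanSpace ℝ (Fin 2)) N]
  [RiemannianBundle (fun x : N ↦ TangentSpace (𝓡 2) x)]

/-- An orientation of the tangent spaces that varies smoothly: near every point there is a smooth
positively oriented frame. -/
def IsSmoothOrientation {n : ℕ} {M : Type*} [TopologicalSpace M]
    [ChartedSpace (EuclideanSpace ℝ (Fin n)) M] [IsManifold (𝓡 n) 1 M]
    [RiemannianBundle (fun x : M ↦ TangentSpace (𝓡 n) x)]
    (o : Π x : M, Orientation ℝ (TangentSpace (𝓡 n) x) (Fin n)) : Prop :=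
  ∀ x : M, ∃ X : Fin n → Π y : M, TangentSpace (𝓡 n) y,
    (∀ i, ContMDiffAt (𝓡 n) (𝓡 n).tangent ∞
      (fun y ↦ (⟨y, X i y⟩ : TangentBundle (𝓡 n) M)) x) ∧ ∀ᶠ y in 𝓝 x, 0 < (o y).volumeForm (fun i ↦ X i y)

/-- `φ` is a Riemannian submersion: its differential at every point is surjective and isometric on
the orthogonal complement of its kernel. -/
def IsRiemannianSubmersion (φ : C^∞⟮𝓡 3, M; 𝓡 2, N⟯) : Prop :=
  ∀ x : M, Function.Surjective (mfderiv (𝓡 3) (𝓡 2) φ x) ∧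
    ∀ v : TangentSpace (𝓡 3) x,
      (∀ w : TangentSpace (𝓡 3) x, mfderiv (𝓡 3) (𝓡 2) φ x w = 0 → inner ℝ v w = 0) →
        ‖mfderiv (𝓡 3) (𝓡 2) φ x v‖ = ‖v‖

/-- The one-form `ν = *φ^*(vol_N)` on `M`. -/
def fiberForm (φ : C^∞⟮𝓡 3, M; 𝓡 2, N⟯)
    (oM : Π x : M, Orientation ℝ (TangentSpace (𝓡 3) x) (Fin 3))
    (oN : Π x : N, Orientation ℝ (TangentSpace (𝓡 2) x) (Fin 2)) (x : M) :
    TangentSpace (𝓡 3) x →L[ℝ] ℝ :=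
  hodgeStar (oM x) ((oN (φ x)).areaForm.compl₁₂
    (mfderiv (𝓡 3) (𝓡 2) φ x : TangentSpace (𝓡 3) x →ₗ[ℝ] TangentSpace (𝓡 2) (φ x))
    (mfderiv (𝓡 3) (𝓡 2) φ x : TangentSpace (𝓡 3) x →ₗ[ℝ] TangentSpace (𝓡 2) (φ x)))

/-- The one-form `*dα`, for a one-form `α` on `M`. -/
def hodgeExtDeriv [IsManifold (𝓡 3) 2 M]
    (oM : Π x : M, Orientation ℝ (TangentSpace (𝓡 3) x) (Fin 3))
    (α : Π x : M, TangentSpace (𝓡 3) x →L[ℝ] ℝ) (x : M) : TangentSpace (𝓡 3) x →L[ℝ] ℝ :=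
  hodgeStar (oM x) (oneFormExtDeriv α x).toLinearMap₁₂

variable {V : N → Type*} [∀ x, NormedAddCommGroup (V x)] [∀ x, InnerProductSpace ℂ (V x)]

/-- The Clifford multiplication `σ_M` on the induced bundle `φ *ᵖ V`. -/
def liftedClifford (φ : C^∞⟮𝓡 3, M; 𝓡 2, N⟯)
    (oM : Π x : M, Orientation ℝ (TangentSpace (𝓡 3) x) (Fin 3))
    (oN : Π x : N, Orientation ℝ (TangentSpace (𝓡 2) x) (Fin 2))
    (σ : Π x : N, (TangentSpace (𝓡 2) x →L[ℝ] ℝ) →ₗ[ℝ] Module.End ℂ (V x)) (x : M) :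
    (TangentSpace (𝓡 3) x →L[ℝ] ℝ) →ₗ[ℝ] Module.End ℂ (V (φ x)) :=
  liftClifford (V := TangentSpace (𝓡 3) x) (W := TangentSpace (𝓡 2) (φ x))
    (mfderiv (𝓡 3) (𝓡 2) φ x) (oN (φ x)) (fiberForm φ oM oN x) (σ (φ x))

variable {F : Type*} [NormedAddCommGroup F] [NormedSpace ℝ F] [FiniteDimensional ℝ F]
  [TopologicalSpace (TotalSpace F V)] [FiberBundle F V] [VectorBundle ℝ F V]
  [IsManifold (𝓡 3) 2 M]
  [IsContMDiffRiemannianBundle (𝓡 3) 1 (EuclideanSpace ℝ (Fin 3))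
    (fun x : M ↦ TangentSpace (𝓡 3) x)]

/-- The lifted connection
`∇^M_X = φ^*(D)_X - ½ σ_M(ν) σ_M(∇_X ν) - (i/4) ν(X) (ν, *dν) σ_M(ν)` on `φ *ᵖ V`. -/
def liftedConnection (φ : C^∞⟮𝓡 3, M; 𝓡 2, N⟯)
    (oM : Π x : M, Orientation ℝ (TangentSpace (𝓡 3) x) (Fin 3))
    (oN : Π x : N, Orientation ℝ (TangentSpace (𝓡 2) x) (Fin 2))
    (σ : Π x : N, (TangentSpace (𝓡 2) x →L[ℝ] ℝ) →ₗ[ℝ] Module.End ℂ (V x))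
    (D : CovariantDerivative (𝓡 2) F V) : CovariantDerivative (𝓡 3) F (φ *ᵖ V) :=
  (inducedConnection φ D).addOneForm fun x ↦
    haveI : FiniteDimensional ℝ (V (φ x)) := VectorBundle.finiteDimensional ℝ F V (φ x)
    spinCorrection (V := TangentSpace (𝓡 3) x) (S := V (φ x)) (liftedClifford φ oM oN σ x)
      (fiberForm φ oM oN x)
      (dualConnection (leviCivita (𝓡 3) M) (fiberForm φ oM oN) x)
      (coInner (fiberForm φ oM oN x) (hodgeExtDeriv oM (fiberForm φ oM oN) x))

end Submersion

end

end SpinSubmersion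

/-! ### Volume forms, the Hodge star and adapted bases in dimensions two and three -/

namespace SpinSubmersion

section LinearAlgebra

variable {V W : Type*} [NormedAddCommGroup V] [InnerProductSpace ℝ V] [FiniteDimensional ℝ V]
  [NormedAddCommGroup W] [InnerProductSpace ℝ W] [FiniteDimensional ℝ W]

/-! Fix a point and take an orthonormal basis `e 0, e 1, e 2` whose first two vectors are the
horizontal lifts of a positive orthonormal basis `f 0, f 1` of the plane, and whose last vector is
vertical and dual to `ν`. The Clifford sum does not depend on the basis, so the Dirac operator on
`M` may be computed here. By the chain rule the induced connection differentiates `ξ ∘ φ` along `e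
j` as `D` differentiates `ξ` along `φ_* (e j)`; the vertical term vanishes and the horizontal ones
give the Dirac operator on `N`.

What is left is of order zero in `ξ` and depends on `B = ∇ν` only. Since `ν` has length one, `B v (e
2) = 0`. Moreover `B (e 0) (e 0) = B (e 1) (e 1) = 0`. The two-form `dν` is the alternation of `B`,
so `*dν` is a combination of the surviving entries of `B`, and the Clifford relations turn the
correction terms into the stated endomorphism. This is `sum_lift_eq`.

The geometric input is that `B` vanishes on the diagonal of horizontal vectors
(`dualConnection_fiberForm_horizontalLift`). A horizontal vector extends to the gradient of `u = g ∘
φ`. This gradient is horizontal, so `ν` vanishes on it, and its squared length is pulled back from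
`N`, so it is constant along the fibres. Symmetry of the Hessian gives `(∇ν)(grad u, grad u) = -Hess
u (grad u, n) = -½ n |grad u|² = 0`, with `n` the unit vertical field dual to `ν`
(`dualConnection_grad_grad`).

These arguments need `ν` to be differentiable, although it is defined by orthonormal bases chosen
point by point. In a smooth positive frame the volume form is the square root of a Gram determinant,
so `ν` is a quotient of expressions in the metric and the differential of `φ`
(`oneFormDiffAt_fiberForm`). -/

theorem volumeForm_finOrthonormalBasis {n : ℕ} (hn : 0 < n) [Fact (Module.finrank ℝ V = n)]
    (o : Orientation ℝ V (Fin n)) :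
    o.volumeForm = (o.finOrthonormalBasis hn Fact.out).toBasis.det :=
  o.volumeForm_robust _ (o.finOrthonormalBasis_orientation hn Fact.out)

theorem volumeForm_three [Fact (Module.finrank ℝ V = 3)] (o : Orientation ℝ V (Fin 3))
    (a b c : V) :
    let e := o.finOrthonormalBasis (by norm_num) Fact.out
    o.volumeForm ![a, b, c] =
      inner ℝ (e 0) a * inner ℝ (e 1) b * inner ℝ (e 2) c
      - inner ℝ (e 0) a * inner ℝ (e 2) b * inner ℝ (e 1) c
      - inner ℝ (e 1) a * inner ℝ (e 0) b * inner ℝ (e 2) c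
      + inner ℝ (e 1) a * inner ℝ (e 2) b * inner ℝ (e 0) c
      + inner ℝ (e 2) a * inner ℝ (e 0) b * inner ℝ (e 1) c
      - inner ℝ (e 2) a * inner ℝ (e 1) b * inner ℝ (e 0) c := by
  intro e
  rw [volumeForm_finOrthonormalBasis (by norm_num) o, Module.Basis.det_apply, Matrix.det_fin_three]
  simp only [Module.Basis.toMatrix_apply, OrthonormalBasis.coe_toBasis_repr_apply,
    OrthonormalBasis.repr_apply_apply, Matrix.cons_val]
  ring

theorem areaForm_eq [Fact (Module.finrank ℝ W = 2)] (o : Orientation ℝ W (Fin 2)) (p q : W) :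
    let f := o.finOrthonormalBasis (by norm_num) Fact.out
    o.areaForm p q = inner ℝ (f 0) p * inner ℝ (f 1) q - inner ℝ (f 1) p * inner ℝ (f 0) q := by
  intro f
  rw [o.areaForm_to_volumeForm, volumeForm_finOrthonormalBasis (by norm_num) o,
    Module.Basis.det_apply, Matrix.det_fin_two]
  simp only [Module.Basis.toMatrix_apply, OrthonormalBasis.coe_toBasis_repr_apply,
    OrthonormalBasis.repr_apply_apply, Matrix.cons_val]
  ring

/-- Multiplicativity of determinants: the right-hand side is the determinant of the mixed Gram
matrix. It removes the orientation from products of areas. -/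
theorem areaForm_mul_areaForm [Fact (Module.finrank ℝ W = 2)] (o : Orientation ℝ W (Fin 2))
    (p q y z : W) : o.areaForm p q * o.areaForm y z =
      inner ℝ p y * inner ℝ q z - inner ℝ p z * inner ℝ q y := by
  let f := o.finOrthonormalBasis (by norm_num) Fact.out
  have h (v w : W) : inner ℝ v w = inner ℝ (f 0) v * inner ℝ (f 0) w
      + inner ℝ (f 1) v * inner ℝ (f 1) w := by
    rw [← f.sum_inner_mul_inner v w, Fin.sum_univ_two, real_inner_comm v, real_inner_comm v]
  rw [areaForm_eq, areaForm_eq, h p y, h q z, h p z, h q y]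
  ring

theorem inner_three [Fact (Module.finrank ℝ V = 3)] (e : OrthonormalBasis (Fin 3) ℝ V) (v w : V) :
    inner ℝ v w = inner ℝ (e 0) v * inner ℝ (e 0) w + inner ℝ (e 1) v * inner ℝ (e 1) w
      + inner ℝ (e 2) v * inner ℝ (e 2) w := by
  rw [← e.sum_inner_mul_inner v w, Fin.sum_univ_three, real_inner_comm v, real_inner_comm v,
    real_inner_comm v]

/-- The right-hand side is the Gram determinant. For a positive frame its root is the volume, which
is thereby expressed by the metric alone. -/
theorem volumeForm_sq [Fact (Module.finrank ℝ V = 3)] (o : Orientation ℝ V (Fin 3))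
    (a b c : V) : o.volumeForm ![a, b, c] ^ 2 =
      inner ℝ a a * inner ℝ b b * inner ℝ c c + 2 * inner ℝ a b * inner ℝ b c * inner ℝ a c
      - inner ℝ a a * inner ℝ b c ^ 2 - inner ℝ b b * inner ℝ a c ^ 2
      - inner ℝ c c * inner ℝ a b ^ 2 := by
  let e := o.finOrthonormalBasis (by norm_num) Fact.out
  rw [volumeForm_three, inner_three e a a, inner_three e b b, inner_three e c c,
    inner_three e a b, inner_three e b c, inner_three e a c]
  ring

/-- The Hodge star of an alternating form, in terms of arbitrary vectors. -/
theorem hodgeStar_mul_volumeForm [Fact (Module.finrank ℝ V = 3)] (o : Orientation ℝ V (Fin 3))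
    {β : V →ₗ[ℝ] V →ₗ[ℝ] ℝ} (hβ : ∀ v, β v v = 0) (a b c w : V) :
    hodgeStar o β w * o.volumeForm ![a, b, c] =
      β a b * inner ℝ c w + β b c * inner ℝ a w + β c a * inner ℝ b w := by
  let e := o.finOrthonormalBasis (by norm_num) Fact.out
  have hswap (v w : V) : β v w = - β w v := by
    have := hβ (v + w)
    simp only [map_add, LinearMap.add_apply, hβ, zero_add, add_zero] at this
    linarith
  have hexp (v w : V) : β v w =
      (inner ℝ (e 0) v * inner ℝ (e 1) w - inner ℝ (e 1) v * inner ℝ (e 0) w) * β (e 0) (e 1)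
      + (inner ℝ (e 1) v * inner ℝ (e 2) w - inner ℝ (e 2) v * inner ℝ (e 1) w) * β (e 1) (e 2)
      + (inner ℝ (e 2) v * inner ℝ (e 0) w - inner ℝ (e 0) v * inner ℝ (e 2) w)
        * β (e 2) (e 0) := by
    conv_lhs => rw [← e.sum_repr v, ← e.sum_repr w]
    simp only [Fin.sum_univ_three, OrthonormalBasis.repr_apply_apply, map_add, map_smul,
      LinearMap.add_apply, LinearMap.smul_apply, smul_eq_mul, hβ]
    rw [hswap (e 1) (e 0), hswap (e 2) (e 1), hswap (e 0) (e 2)]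
    ring
  have hstar : hodgeStar o β w = β (e 0) (e 1) * inner ℝ (e 2) w
      + β (e 1) (e 2) * inner ℝ (e 0) w + β (e 2) (e 0) * inner ℝ (e 1) w := rfl
  -- For the vector `s` dual to the star of `β` one has `β a b = vol(s, a, b)`, so the claim is
  -- Cramer's rule for `s` in terms of `a, b, c`, paired with `w`. In coordinates it is a polynomial
  -- identity.
  rw [hstar, volumeForm_three, inner_three e a w, inner_three e b w, inner_three e c w,
    hexp a b, hexp b c, hexp c a]
  ring

/-- By polarization `A` preserves inner products on the complement of its kernel, so the adjoint of
`A` inverts `A` there; and every value of `A` is attained on that complement. -/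
theorem comp_adjoint_of_isometric {A : V →L[ℝ] W} (hA : Function.Surjective A)
    (hiso : ∀ v, (∀ w, A w = 0 → inner ℝ v w = 0) → ‖A v‖ = ‖v‖) (w : W) :
    A (ContinuousLinearMap.adjoint A w) = w := by
  let K := LinearMap.ker (A : V →ₗ[ℝ] W)
  have hiso' (v) (hv : v ∈ Kᗮ) : ‖A v‖ = ‖v‖ :=
    hiso v fun w hw ↦ K.inner_left_of_mem_orthogonal (u := w) hw hv
  have hinner (v v') (hv : v ∈ Kᗮ) (hv' : v' ∈ Kᗮ) : inner ℝ (A v) (A v') = inner ℝ v v' := by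
    rw [real_inner_eq_norm_add_mul_self_sub_norm_mul_self_sub_norm_mul_self_div_two,
      real_inner_eq_norm_add_mul_self_sub_norm_mul_self_sub_norm_mul_self_div_two, ← map_add,
      hiso' _ hv, hiso' _ hv', hiso' _ (Kᗮ.add_mem hv hv')]
  have hsplit (v : V) : ∃ a ∈ K, ∃ b ∈ Kᗮ, v = a + b :=
    K.exists_add_mem_mem_orthogonal v
  obtain ⟨v, rfl⟩ := hA w
  obtain ⟨a, ha, b, hb, rfl⟩ := hsplit v
  have ha' : A a = 0 := ha
  rw [map_add, ha', zero_add]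
  congr 1
  refine ext_inner_right ℝ fun v' ↦ ?_
  obtain ⟨c, hc, d, hd, rfl⟩ := hsplit v'
  have hc' : A c = 0 := hc
  rw [ContinuousLinearMap.adjoint_inner_left, map_add, hc', zero_add, hinner _ _ hb hd,
    inner_add_right, K.inner_left_of_mem_orthogonal hc hb, zero_add]

/-- An orthonormal basis of `V`, of volume one, that extends the horizontal lift of an
orthonormal pair in `W`. -/
theorem exists_adapted_basis [Fact (Module.finrank ℝ V = 3)] (o : Orientation ℝ V (Fin 3))
    {A : V →L[ℝ] W} (hA : ∀ w, A (ContinuousLinearMap.adjoint A w) = w)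
    (f : OrthonormalBasis (Fin 2) ℝ W) :
    ∃ e : OrthonormalBasis (Fin 3) ℝ V, e 0 = ContinuousLinearMap.adjoint A (f 0) ∧
      e 1 = ContinuousLinearMap.adjoint A (f 1) ∧ A (e 2) = 0 ∧
      o.volumeForm ![e 0, e 1, e 2] = 1 := by
  have hin (p q : W) : inner ℝ (ContinuousLinearMap.adjoint A p)
      (ContinuousLinearMap.adjoint A q) = inner ℝ p q := by
    rw [ContinuousLinearMap.adjoint_inner_left, hA]
  have hcard : Module.finrank ℝ V = Fintype.card (Fin 3) := Fact.out (p := Module.finrank ℝ V = 3)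
  obtain ⟨e, he⟩ := Orthonormal.exists_orthonormalBasis_extension_of_card_eq (𝕜 := ℝ) hcard
    (v := ![ContinuousLinearMap.adjoint A (f 0), ContinuousLinearMap.adjoint A (f 1), 0])
    (s := {0, 1}) (by
      rw [orthonormal_iff_ite]
      rintro ⟨i, hi⟩ ⟨j, hj⟩
      have h (i j) := (hin (f i) (f j)).trans (f.inner_eq_ite i j)
      simp only [Subtype.mk.injEq, Set.restrict_apply]
      rcases hi with rfl | rfl <;> rcases hj with rfl | rfl
      exacts [h 0 0, h 0 1, h 1 0, h 1 1])
  have he0 : e 0 = ContinuousLinearMap.adjoint A (f 0) := he 0 (by simp)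
  have he1 : e 1 = ContinuousLinearMap.adjoint A (f 1) := he 1 (by simp)
  have he2 : A (e 2) = 0 := by
    refine f.repr.injective (PiLp.ext fun i ↦ ?_)
    rw [map_zero, f.repr_apply_apply, ← ContinuousLinearMap.adjoint_inner_left]
    fin_cases i
    · have := e.inner_eq_ite 0 2
      rw [he0] at this
      simpa using this
    · have := e.inner_eq_ite 1 2
      rw [he1] at this
      simpa using this
  have hvol : |o.volumeForm ![e 0, e 1, e 2]| = 1 := by
    rw [← o.abs_volumeForm_apply_of_orthonormal e]
    congr 2
    ext i
    fin_cases i <;> rfl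
  rcases (abs_eq zero_le_one).1 hvol with h | h
  · exact ⟨e, he0, he1, he2, h⟩
  -- With volume `-1`, flip the vertical vector; the horizontal lifts stay in place.
  · obtain ⟨e', he'⟩ := Orthonormal.exists_orthonormalBasis_extension_of_card_eq (𝕜 := ℝ) hcard
      (v := ![e 0, e 1, - e 2]) (s := Set.univ) (by
        rw [orthonormal_iff_ite]
        rintro ⟨i, -⟩ ⟨j, -⟩
        fin_cases i <;> fin_cases j <;> simp)
    have h0 : e' 0 = e 0 := he' 0 trivial
    have h1 : e' 1 = e 1 := he' 1 trivial
    have h2 : e' 2 = - e 2 := he' 2 trivial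
    refine ⟨e', h0.trans he0, h1.trans he1, by rw [h2, map_neg, he2, neg_zero], ?_⟩
    rw [h0, h1, h2]
    rw [volumeForm_three] at h ⊢
    simp only [inner_neg_right] at h ⊢
    linarith

end LinearAlgebra

end SpinSubmersion

/-! ### The dual of the pulled back area form, and traces over orthonormal bases -/

namespace SpinSubmersion

section LinearAlgebra

variable {V W : Type*} [NormedAddCommGroup V] [InnerProductSpace ℝ V] [FiniteDimensional ℝ V]
  [NormedAddCommGroup W] [InnerProductSpace ℝ W] [FiniteDimensional ℝ W]

/-- The pull-back of the area form along `A`. -/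
theorem hodgeStar_pullback [Fact (Module.finrank ℝ V = 3)] [Fact (Module.finrank ℝ W = 2)]
    (o : Orientation ℝ V (Fin 3)) (oW : Orientation ℝ W (Fin 2)) {A : V →L[ℝ] W}
    {e : OrthonormalBasis (Fin 3) ℝ V} (he : o.volumeForm ![e 0, e 1, e 2] = 1)
    (h2 : A (e 2) = 0) (h01 : oW.areaForm (A (e 0)) (A (e 1)) = 1) :
    hodgeStar o (oW.areaForm.compl₁₂ (A : V →ₗ[ℝ] W) (A : V →ₗ[ℝ] W)) = innerSL ℝ (e 2) := by
  ext w
  have := hodgeStar_mul_volumeForm o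
    (β := oW.areaForm.compl₁₂ (A : V →ₗ[ℝ] W) (A : V →ₗ[ℝ] W)) (fun v ↦ by simp) (e 0) (e 1) (e 2) w
  simpa [he, h2, h01] using this

theorem areaForm_finOrthonormalBasis [Fact (Module.finrank ℝ W = 2)]
    (o : Orientation ℝ W (Fin 2)) :
    let f := o.finOrthonormalBasis (by norm_num) Fact.out
    o.areaForm (f 0) (f 1) = 1 := by
  simp [areaForm_eq]

/-- The sum in the Dirac operator does not depend on the orthonormal basis. -/
theorem sum_orthonormalBasis_eq {S : Type*} [AddCommGroup S] [Module ℝ S]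
    (T : V →ₗ[ℝ] V →ₗ[ℝ] S) {ι κ : Type*} [Fintype ι] [Fintype κ]
    (e : OrthonormalBasis ι ℝ V) (f : OrthonormalBasis κ ℝ V) :
    ∑ j, T (f j) (f j) = ∑ j, T (e j) (e j) := by
  have h1 (j) : T (f j) (f j) = ∑ k, inner ℝ (e k) (f j) • T (f j) (e k) := by
    conv_lhs => rw [← e.sum_repr' (f j), e.sum_repr' (f j)]
    conv_lhs => enter [2]; rw [← e.sum_repr' (f j)]
    simp
  have h2 (k) : T (e k) (e k) = ∑ j, inner ℝ (f j) (e k) • T (f j) (e k) := by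
    conv_lhs => enter [1]; rw [← f.sum_repr' (e k)]
    simp
  simp_rw [h1, h2]
  rw [Finset.sum_comm]
  simp_rw [real_inner_comm]

end LinearAlgebra

/-! ### Clifford relations from trace identities in rank two -/

section Clifford

variable {S : Type*} [AddCommGroup S] [Module ℂ S]

/-- Cayley–Hamilton: a trace-free endomorphism in rank two squares to minus its determinant, and
taking traces identifies this scalar. -/
theorem mul_self_of_trace_eq_zero (hS : Module.finrank ℂ S = 2) {A : Module.End ℂ S}
    (hA : LinearMap.trace ℂ S A = 0) :
    A * A = ((1 / 2 : ℂ) * LinearMap.trace ℂ S (A * A)) • (1 : Module.End ℂ S) := by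
  have : Module.Finite ℂ S := Module.finite_of_finrank_pos (by omega)
  let b := Module.finBasisOfFinrankEq ℂ S hS
  apply (LinearMap.toMatrixAlgEquiv b).injective
  rw [LinearMap.trace_eq_matrix_trace ℂ b] at hA ⊢
  have h : LinearMap.toMatrix b b (A * A) = LinearMap.toMatrix b b A * LinearMap.toMatrix b b A :=
    LinearMap.toMatrix_mul b A A
  rw [h, map_mul, map_smul, map_one]
  change LinearMap.toMatrix b b A * LinearMap.toMatrix b b A = _
  generalize LinearMap.toMatrix b b A = m at hA
  rw [Matrix.trace_fin_two] at hA
  have hm : m 1 1 = - m 0 0 := by linear_combination hA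
  ext i j
  fin_cases i <;> fin_cases j <;>
    simp [Matrix.mul_apply, Matrix.trace_fin_two, Fin.sum_univ_two, hm] <;> ring

/-- Polarization of the square. With the normalization `½ Tr(σ(α) σ(β)) = (α, β)` this is the
Clifford relation. -/
theorem mul_add_mul_of_trace_eq_zero (hS : Module.finrank ℂ S = 2) {A B : Module.End ℂ S}
    (hA : LinearMap.trace ℂ S A = 0) (hB : LinearMap.trace ℂ S B = 0) :
    A * B + B * A = LinearMap.trace ℂ S (A * B) • (1 : Module.End ℂ S) := by
  have h := mul_self_of_trace_eq_zero hS (A := A + B) (by rw [map_add, hA, hB, add_zero])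
  have hA' := mul_self_of_trace_eq_zero hS hA
  have hB' := mul_self_of_trace_eq_zero hS hB
  have h' : (A + B) * (A + B) = A * A + (A * B + B * A) + B * B := by noncomm_ring
  have ht : LinearMap.trace ℂ S ((A + B) * (A + B)) = LinearMap.trace ℂ S (A * A)
      + 2 * LinearMap.trace ℂ S (A * B) + LinearMap.trace ℂ S (B * B) := by
    rw [h', map_add, map_add, map_add, LinearMap.trace_mul_comm ℂ B A]
    ring
  rw [ht, h'] at h
  linear_combination (norm := module) h - hA' - hB'

end Clifford

/-! ### The pointwise computation of the lifted Dirac operator -/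

section Lift

variable {V W : Type*} [NormedAddCommGroup V] [InnerProductSpace ℝ V] [FiniteDimensional ℝ V]
  [NormedAddCommGroup W] [InnerProductSpace ℝ W] [FiniteDimensional ℝ W]
  {S : Type*} [NormedAddCommGroup S] [InnerProductSpace ℂ S]

theorem coInner_innerSL (v w : V) : coInner (innerSL ℝ v) (innerSL ℝ w) = inner ℝ v w := by
  have h (v : V) : (InnerProductSpace.toDual ℝ V).symm (innerSL ℝ v) = v :=
    (InnerProductSpace.toDual ℝ V).symm_apply_apply v
  rw [coInner, h, h]

theorem covector_eq_sum (e : OrthonormalBasis (Fin 3) ℝ V) (α : V →L[ℝ] ℝ) :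
    α = α (e 0) • innerSL ℝ (e 0) + α (e 1) • innerSL ℝ (e 1) + α (e 2) • innerSL ℝ (e 2) := by
  ext v
  conv_lhs => rw [← e.sum_repr' v]
  simp [Fin.sum_univ_three, mul_comm]

/-- The sum is the trace of a bilinear map; this permits the passage to an adapted basis. -/
theorem sum_clifford_eq (σ : (V →L[ℝ] ℝ) →ₗ[ℝ] Module.End ℂ S) (G : V →L[ℝ] S)
    {ι κ : Type*} [Fintype ι] [Fintype κ]
    (e : OrthonormalBasis ι ℝ V) (f : OrthonormalBasis κ ℝ V) :
    ∑ j, σ (innerSL ℝ (f j)) (G (f j)) = ∑ j, σ (innerSL ℝ (e j)) (G (e j)) :=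
  sum_orthonormalBasis_eq (LinearMap.mk₂ ℝ (fun v w ↦ σ (innerSL ℝ v) (G w))
    (fun v v' w ↦ by simp) (fun c v w ↦ by simp) (fun v w w' ↦ by simp)
    (fun c v w ↦ by rw [map_smul, LinearMap.map_smul_of_tower])) e f

theorem liftClifford_apply [Fact (Module.finrank ℝ W = 2)] (A : V →L[ℝ] W) (o : Orientation ℝ W (Fin 2)) (ν : V →L[ℝ] ℝ)
    (σ : (W →L[ℝ] ℝ) →ₗ[ℝ] Module.End ℂ S) (α : V →L[ℝ] ℝ) :
    let f := o.finOrthonormalBasis (by norm_num) Fact.out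
    liftClifford A o ν σ α = σ (α.comp (ContinuousLinearMap.adjoint A)) +
      ((coInner α ν : ℝ) : ℂ) • (-Complex.I • (σ (innerSL ℝ (f 0)) * σ (innerSL ℝ (f 1)))) :=
  rfl

theorem spinCorrection_apply [FiniteDimensional ℝ S] (σ : (V →L[ℝ] ℝ) →ₗ[ℝ] Module.End ℂ S)
    (ν : V →L[ℝ] ℝ) (B : V →L[ℝ] V →L[ℝ] ℝ) (κ : ℝ) (ψ : S) (X : V) :
    spinCorrection σ ν B κ ψ X = -(1 / 2 : ℂ) • σ ν (σ (B X) ψ)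
      - (Complex.I / 4 * (ν X : ℂ) * (κ : ℂ)) • σ ν ψ :=
  rfl

/-- The zeroth order terms of the lifted Dirac operator. -/
theorem sum_lift_eq [Fact (Module.finrank ℝ V = 3)] [Fact (Module.finrank ℝ W = 2)]
    [FiniteDimensional ℝ S] (hS : Module.finrank ℂ S = 2)
    (oV : Orientation ℝ V (Fin 3)) (oW : Orientation ℝ W (Fin 2))
    {σ : (W →L[ℝ] ℝ) →ₗ[ℝ] Module.End ℂ S}
    (htr : ∀ α, LinearMap.trace ℂ S (σ α) = 0)
    (hiso : ∀ α β, (1 / 2 : ℂ) * LinearMap.trace ℂ S (σ α * σ β) = (coInner α β : ℝ))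
    {A : V →L[ℝ] W} (hA : ∀ w, A (ContinuousLinearMap.adjoint A w) = w)
    {ν : V →L[ℝ] ℝ}
    (hν : ν = hodgeStar oV (oW.areaForm.compl₁₂ (A : V →ₗ[ℝ] W) (A : V →ₗ[ℝ] W)))
    {B dν : V →L[ℝ] V →L[ℝ] ℝ} (hd : ∀ v w, dν v w = B v w - B w v)
    (hB : ∀ n v, innerSL ℝ n = ν → B v n = 0)
    (hB' : ∀ w, B (ContinuousLinearMap.adjoint A w) (ContinuousLinearMap.adjoint A w) = 0)
    (L : W →L[ℝ] S) (ψ : S) {ι κ : Type*} [Fintype ι] [Fintype κ]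
    (e : OrthonormalBasis ι ℝ V) (f : OrthonormalBasis κ ℝ W) :
    let s := hodgeStar oV dν.toLinearMap₁₂
    let σV := liftClifford A oW ν σ
    (-Complex.I) • ∑ j, σV (innerSL ℝ (e j))
        (L (A (e j)) + spinCorrection σV ν B (coInner ν s) ψ (e j)) =
      (-Complex.I) • ∑ j, σ (innerSL ℝ (f j)) (L (f j)) +
        (1 / 2 : ℂ) • σV (s - (1 / 2 * coInner ν s) • ν) (σV ν ψ) := by
  intro s σV
  let f' := oW.finOrthonormalBasis (by norm_num) Fact.out
  obtain ⟨e', he0, he1, hA2, hvol⟩ := exists_adapted_basis oV hA f'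
  have hA0 : A (e' 0) = f' 0 := by rw [he0, hA]
  have hA1 : A (e' 1) = f' 1 := by rw [he1, hA]
  have hν' : ν = innerSL ℝ (e' 2) := by
    rw [hν]
    refine hodgeStar_pullback oV oW hvol hA2 ?_
    rw [hA0, hA1]
    exact areaForm_finOrthonormalBasis oW
  set s0 := σ (innerSL ℝ (f' 0)) with hs0
  set s1 := σ (innerSL ℝ (f' 1)) with hs1
  have hlift (v : V) : (innerSL ℝ v).comp (ContinuousLinearMap.adjoint A) = innerSL ℝ (A v) := by
    ext w
    simp [ContinuousLinearMap.adjoint_inner_right]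
  have hσ (v : V) : σV (innerSL ℝ v) = σ (innerSL ℝ (A v)) +
      ((inner ℝ v (e' 2) : ℝ) : ℂ) • (-Complex.I • (s0 * s1)) := by
    simp only [σV]
    rw [liftClifford_apply, hlift, hν', coInner_innerSL]
  have hσ0 : σV (innerSL ℝ (e' 0)) = s0 := by
    rw [hσ, hA0, e'.inner_eq_ite]
    simp [hs0]
  have hσ1 : σV (innerSL ℝ (e' 1)) = s1 := by
    rw [hσ, hA1, e'.inner_eq_ite]
    simp [hs1]
  have hσ2 : σV (innerSL ℝ (e' 2)) = -Complex.I • (s0 * s1) := by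
    rw [hσ, hA2, e'.inner_eq_ite]
    simp
  have hsq (v : W) (hv : inner ℝ v v = (1 : ℝ)) (x : S) :
      σ (innerSL ℝ v) (σ (innerSL ℝ v) x) = x := by
    have := mul_self_of_trace_eq_zero hS (htr (innerSL ℝ v))
    rw [hiso, coInner_innerSL, hv, Complex.ofReal_one, one_smul] at this
    exact LinearMap.congr_fun this x
  have h00 (x : S) : s0 (s0 x) = x := hsq _ (by simp) x
  have h11 (x : S) : s1 (s1 x) = x := hsq _ (by simp) x
  have h10 (x : S) : s1 (s0 x) = - s0 (s1 x) := by
    have h := mul_add_mul_of_trace_eq_zero hS (htr (innerSL ℝ (f' 1))) (htr (innerSL ℝ (f' 0)))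
    have h' := hiso (innerSL ℝ (f' 1)) (innerSL ℝ (f' 0))
    rw [coInner_innerSL, f'.inner_eq_ite, if_neg (by decide), Complex.ofReal_zero,
      mul_eq_zero_iff_left (by norm_num)] at h'
    rw [h', zero_smul] at h
    exact eq_neg_of_add_eq_zero_left (LinearMap.congr_fun h x)
  -- Of the nine entries of `B` in the adapted basis, these facts leave only those at `(0,1)`,
  -- `(1,0)`, `(2,0)` and `(2,1)`.
  have hB2 (v : V) : B v (e' 2) = 0 := hB _ v hν'.symm
  have hB0 : B (e' 0) (e' 0) = 0 := he0 ▸ hB' (f' 0)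
  have hB1 : B (e' 1) (e' 1) = 0 := he1 ▸ hB' (f' 1)
  have hs : s = (B (e' 0) (e' 1) - B (e' 1) (e' 0)) • innerSL ℝ (e' 2)
      + (-B (e' 2) (e' 1)) • innerSL ℝ (e' 0) + B (e' 2) (e' 0) • innerSL ℝ (e' 1) := by
    ext w
    have := hodgeStar_mul_volumeForm oV (β := dν.toLinearMap₁₂) (fun v ↦ by simp [hd])
      (e' 0) (e' 1) (e' 2) w
    rw [hvol, mul_one] at this
    rw [show s w = _ from this]
    change dν (e' 0) (e' 1) * _ + dν (e' 1) (e' 2) * _ + dν (e' 2) (e' 0) * _ = _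
    simp [hd, hB2]
  have hκ : coInner ν s = B (e' 0) (e' 1) - B (e' 1) (e' 0) := by
    have h (a b : ℝ) (α β γ : V →L[ℝ] ℝ) : coInner α (a • β + b • γ) =
      a * coInner α β + b * coInner α γ := by
        simp [coInner, inner_add_right, real_inner_smul_right]
    have h' (α β γ : V →L[ℝ] ℝ) : coInner α (β + γ) = coInner α β + coInner α γ := by
        simp [coInner, inner_add_right]
    have h'' (a : ℝ) (α β : V →L[ℝ] ℝ) : coInner α (a • β) = a * coInner α β := by
        simp [coInner, real_inner_smul_right]
    rw [hs, hν', h', h, h'', coInner_innerSL, coInner_innerSL, coInner_innerSL]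
    simp [e'.inner_eq_ite]
  have hcov (v : V) : B v = B v (e' 0) • innerSL ℝ (e' 0) + B v (e' 1) • innerSL ℝ (e' 1) := by
    conv_lhs => rw [covector_eq_sum e' (B v)]
    rw [hB2, zero_smul, add_zero]
  have hG := sum_clifford_eq σV (L.comp A + spinCorrection σV ν B (coInner ν s) ψ) e' e
  simp only [ContinuousLinearMap.add_apply, ContinuousLinearMap.comp_apply] at hG
  rw [hG, sum_clifford_eq σ L f' f, Fin.sum_univ_three, Fin.sum_univ_two, hκ]
  simp only [spinCorrection_apply, hA0, hA1, hA2, hσ0, hσ1, hσ2, hν', ← hs0, ← hs1]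
  rw [hcov (e' 0), hcov (e' 1), hcov (e' 2), hs, hB0, hB1]
  -- The identity holds for independent values of the four entries: `b01` and `b10` enter only
  -- through their difference `(ν, *dν)`.
  generalize B (e' 0) (e' 1) = b01
  generalize B (e' 1) (e' 0) = b10
  generalize B (e' 2) (e' 0) = b20
  generalize B (e' 2) (e' 1) = b21
  have hsm (r : ℝ) (x : S) : r • x = (r : ℂ) • x := (Complex.coe_smul r x).symm
  simp only [map_add, map_sub, map_smul, hσ0, hσ1, hσ2, LinearMap.add_apply,
    LinearMap.sub_apply, LinearMap.smul_apply, Module.End.mul_apply, h00, h11, h10, map_neg,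
    smul_neg, innerSL_apply_apply, e'.inner_eq_ite, map_zero, hsm]
  simp [-Complex.coe_smul]
  have hI := Complex.I_sq
  -- With `κ = b01 - b10`, the coefficient of `ψ` on the left is `κ/2` from the `∇ν` term minus
  -- `κ/4` from the last correction. On the right it is `½ (κ - κ/2)`, since `σV ν` squares to one.
  -- The entries `b20` and `b21` give the coefficients of `s0 ψ` and `s1 ψ`.
  match_scalars
  · ring
  · linear_combination (-1 / 4 * Complex.I ^ 2 * (b01 - b10) : ℂ) * hI
  · ring
  · linear_combination (-1 / 2 * Complex.I * b20 : ℂ) * hI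
  · linear_combination (-1 / 2 * Complex.I * b21 : ℂ) * hI
end Lift
end SpinSubmersion

/-! ### Lie brackets and derivatives of functions in a chart -/

namespace SpinSubmersion

section Tangent

variable {E : Type*} [NormedAddCommGroup E] [NormedSpace ℝ E] [FiniteDimensional ℝ E]
  {H : Type*} [TopologicalSpace H] {I : ModelWithCorners ℝ E H} [I.Boundaryless]
  {M : Type*} [TopologicalSpace M] [ChartedSpace H M]

/-- The vector field `X`, read in the chart at `x`. -/
noncomputable def chartField (X : Π x : M, TangentSpace I x) (x : M) : E → E :=
  VectorField.mpullbackWithin 𝓘(ℝ, E) I (extChartAt I x).symm X (Set.range I)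

/-- The chain rule: the derivative of the inverse chart carries the chart field back to `X`. Holding
near the point, the formula can be differentiated again. -/
theorem eventually_mvfderiv_symm [IsManifold I 2 M] {u : M → ℝ} {x : M}
    (hu : ContMDiffAt I 𝓘(ℝ) 2 u x) (X : Π x : M, TangentSpace I x) :
    (fun y ↦ d% u y (X y)) ∘ (extChartAt I x).symm =ᶠ[𝓝 (extChartAt I x x)]
      fun z ↦ fderiv ℝ (u ∘ (extChartAt I x).symm) z (chartField X x z) := by
  have hc : ContinuousAt (extChartAt I x).symm (extChartAt I x x) :=
    continuousAt_extChartAt_symm x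
  have hev := (contMDiffAt_iff_contMDiffAt_nhds (by simp)).1 hu
  rw [← extChartAt_to_inv (I := I) x] at hev
  filter_upwards [hc.eventually hev, extChartAt_target_mem_nhds x] with z hz hzt
  have h1 : MDifferentiableAt 𝓘(ℝ, E) I (extChartAt I x).symm z := by
    have := mdifferentiableWithinAt_extChartAt_symm hzt
    rwa [I.range_eq_univ, mdifferentiableWithinAt_univ] at this
  have h2 := mfderiv_comp z (hz.mdifferentiableAt (by simp)) h1
  have h3 := isInvertible_mfderivWithin_extChartAt_symm hzt
  rw [I.range_eq_univ, mfderivWithin_univ] at h3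
  have h4 : mfderiv 𝓘(ℝ, E) I (extChartAt I x).symm z (chartField (E := E) X x z)
      = X ((extChartAt I x).symm z) := by
    have h5 : chartField X x z =
        (mfderiv 𝓘(ℝ, E) I (extChartAt I x).symm z).inverse (X ((extChartAt I x).symm z)) := by
      rw [← mfderivWithin_univ, ← I.range_eq_univ]
      rfl
    rw [h5]
    exact h3.self_apply_inverse _
  rw [mfderiv_eq_fderiv] at h2
  rw [h2]
  change _ = mfderiv I 𝓘(ℝ) u _ (mfderiv 𝓘(ℝ, E) I (extChartAt I x).symm z (chartField (E := E) X x z))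
  rw [h4]
  rfl

theorem differentiableAt_chartField [IsManifold I 2 M] {X : Π x : M, TangentSpace I x} {x : M}
    (hX : MDiffAt (T% X) x) : DifferentiableAt ℝ (chartField X x) (extChartAt I x x) := by
  have : CompleteSpace E := FiniteDimensional.complete ℝ E
  have h := (hX.mdifferentiableWithinAt
    (s := Set.univ)).differentiableWithinAt_mpullbackWithin_vectorField
  rw [I.range_eq_univ] at h
  rw [chartField, I.range_eq_univ]
  exact (differentiableWithinAt_univ.1 (by simpa only [Set.preimage_univ, Set.univ_inter] using h))

theorem contDiffAt_comp_symm [IsManifold I 2 M] {u : M → ℝ} {x : M}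
    (hu : ContMDiffAt I 𝓘(ℝ) 2 u x) :
    ContDiffAt ℝ 2 (u ∘ (extChartAt I x).symm) (extChartAt I x x) := by
  have h := (contMDiffAt_iff.1 hu).2
  rw [I.range_eq_univ, contDiffWithinAt_univ] at h
  exact h

theorem mdiffAt_of_comp_symm [IsManifold I 1 M] {g : M → ℝ} {x : M}
    (h : DifferentiableAt ℝ (g ∘ (extChartAt I x).symm) (extChartAt I x x)) : MDiffAt g x := by
  have h1 := h.mdifferentiableAt.comp x
    (mdifferentiableAt_extChartAt (I := I) (mem_chart_source H x))
  refine h1.congr_of_eventuallyEq ?_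
  filter_upwards [extChartAt_source_mem_nhds (I := I) x] with y hy
  exact congrArg g ((extChartAt I x).left_inv hy).symm

theorem differentiableAt_fderiv_chartField [IsManifold I 2 M] {u : M → ℝ} {x : M}
    (hu : ContMDiffAt I 𝓘(ℝ) 2 u x) {X : Π x : M, TangentSpace I x} (hX : MDiffAt (T% X) x) :
    DifferentiableAt ℝ (fun z ↦ fderiv ℝ (u ∘ (extChartAt I x).symm) z (chartField X x z))
      (extChartAt I x x) :=
  (((contDiffAt_comp_symm hu).fderiv_right (m := 1) (by norm_num)).differentiableAt
    (by simp)).clm_apply (differentiableAt_chartField hX)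

/-- The derivative of a function along a vector field is differentiable. -/
theorem mdiffAt_mvfderiv_apply [IsManifold I 2 M] {u : M → ℝ} {x : M}
    (hu : ContMDiffAt I 𝓘(ℝ) 2 u x) {X : Π x : M, TangentSpace I x} (hX : MDiffAt (T% X) x) :
    MDiffAt (fun y ↦ d% u y (X y)) x :=
  mdiffAt_of_comp_symm ((differentiableAt_fderiv_chartField hu hX).congr_of_eventuallyEq
    (eventually_mvfderiv_symm hu X))

theorem mvfderiv_eq_fderiv_comp_symm [IsManifold I 1 M] {g : M → ℝ} {x : M} (hg : MDiffAt g x) :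
    d% g x = fderiv ℝ (g ∘ (extChartAt I x).symm) (extChartAt I x x) := by
  have := hg.mvfderiv
  rwa [I.range_eq_univ, fderivWithin_univ] at this

theorem chartField_self [IsManifold I 1 M] (X : Π x : M, TangentSpace I x) (x : M) :
    chartField X x (extChartAt I x x) = X x := by
  have h (y : M) (hy : y = x) : (X y : E) = X x := by rw [hy]
  exact (mfderivWithin_extChartAt_symm_inverse_apply (I := I) (x := x) _).trans
    (h _ (extChartAt_to_inv x))

/-- At its own base point the chart has the identity as differential, so the bracket needs no
transport back. -/
theorem mlieBracket_eq_lieBracket_chartField [IsManifold I 1 M] (X Y : Π x : M, TangentSpace I x)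
    (x : M) : VectorField.mlieBracket I X Y x =
      VectorField.lieBracket ℝ (chartField X x) (chartField Y x) (extChartAt I x x) := by
  have h (T : E →L[ℝ] E) (hT : T = ContinuousLinearMap.id ℝ E) (w : E) : T.inverse w = w := by
    rw [hT, ContinuousLinearMap.inverse_id]
    rfl
  have h' : (extChartAt I x).symm ⁻¹' Set.univ ∩ Set.range I = Set.univ := by
    simp [I.range_eq_univ]
  rw [← VectorField.mlieBracketWithin_univ, VectorField.mlieBracketWithin_apply, h']
  refine (h (mfderiv I 𝓘(ℝ, E) (extChartAt I x) x) mfderiv_extChartAt_self _).trans ?_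
  change VectorField.lieBracketWithin ℝ (chartField X x) (chartField Y x) _ _ = _
  rw [VectorField.lieBracketWithin_univ]

/-- The derivative of a function along a Lie bracket. -/
theorem mvfderiv_mlieBracket [IsManifold I 2 M] {u : M → ℝ} {x : M}
    (hu : ContMDiffAt I 𝓘(ℝ) 2 u x) {X Y : Π x : M, TangentSpace I x}
    (hX : MDiffAt (T% X) x) (hY : MDiffAt (T% Y) x) :
    d% u x (VectorField.mlieBracket I X Y x) =
      d% (fun y ↦ d% u y (Y y)) x (X x) - d% (fun y ↦ d% u y (X y)) x (Y x) := by
  have hd (Z : Π x : M, TangentSpace I x) (hZ : MDiffAt (T% Z) x) :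
      d% (fun y ↦ d% u y (Z y)) x =
        fderiv ℝ (fun z ↦ fderiv ℝ (u ∘ (extChartAt I x).symm) z (chartField Z x z))
          (extChartAt I x x) := by
    rw [mvfderiv_eq_fderiv_comp_symm (mdiffAt_mvfderiv_apply hu hZ)]
    exact (eventually_mvfderiv_symm hu Z).fderiv_eq
  -- In the vector space this is the symmetry of the second derivative, which is why `u` must be
  -- twice continuously differentiable.
  have h := VectorField.fderiv_apply_lieBracket (contDiffAt_comp_symm hu) (by simp)
    (differentiableAt_chartField hY) (differentiableAt_chartField hX)
  rw [← mlieBracket_eq_lieBracket_chartField, chartField_self, chartField_self] at h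
  rw [hd X hX, hd Y hY, mvfderiv_eq_fderiv_comp_symm (hu.mdifferentiableAt (by simp))]
  exact h

/-! ### Criteria for differentiability of one-forms and vector fields -/

/-- A map into a space of linear maps on a finite-dimensional space is differentiable if all
its evaluations are. -/
theorem mdiffAt_clm {G G' : Type*} [NormedAddCommGroup G] [NormedSpace ℝ G]
    [FiniteDimensional ℝ G] [NormedAddCommGroup G'] [NormedSpace ℝ G'] {T : M → G →L[ℝ] G'}
    {x : M} (h : ∀ w, MDiffAt (fun y ↦ T y w) x) : MDiffAt T x := by
  let b := Module.finBasis ℝ G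
  have h1 : T = ∑ i, fun y ↦
      ContinuousLinearMap.smulRightL ℝ G G' (b.coord i).toContinuousLinearMap (T y (b i)) := by
    ext y w
    conv_lhs => rw [← b.sum_repr w, map_sum]
    simp
  rw [h1]
  refine MDifferentiableAt.sum fun i _ ↦ ?_
  exact (ContinuousLinearMap.mdifferentiableAt _).comp x (h (b i))

variable (I) in
/-- The vector field near `x` that is constant, equal to `w`, in the trivialization at `x`. -/
noncomputable def frameField [IsManifold I 1 M] (x : M) (w : E) (y : M) : TangentSpace I y :=
  (trivializationAt E (TangentSpace I) x).symmL ℝ y w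

theorem mdiffAt_frameField [IsManifold I 1 M] (x : M) (w : E) :
    MDiffAt (T% (frameField I x w)) x := by
  rw [mdifferentiableAt_section]
  refine (mdifferentiableAt_const (c := w)).congr_of_eventuallyEq ?_
  filter_upwards [(trivializationAt E (TangentSpace I) x).open_baseSet.mem_nhds
    (FiberBundle.mem_baseSet_trivializationAt' x)] with y hy
  rw [frameField, Trivialization.symmL_apply _ hy, Trivialization.apply_mk_symm _ hy]

/-- A one-form is differentiable if its values on differentiable vector fields are. -/
theorem OneFormDiffAt.of_apply [IsManifold I 1 M] {α : Π x : M, TangentSpace I x →L[ℝ] ℝ} {x : M}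
    (h : ∀ X : Π x : M, TangentSpace I x, MDiffAt (T% X) x → MDiffAt (fun y ↦ α y (X y)) x) :
    OneFormDiffAt α x := by
  rw [OneFormDiffAt, mdifferentiableAt_hom_bundle]
  refine ⟨mdifferentiableAt_id, mdiffAt_clm fun w ↦ ?_⟩
  refine (h (frameField I x w) (mdiffAt_frameField x w)).congr_of_eventuallyEq ?_
  filter_upwards with y
  simp [ContinuousLinearMap.inCoordinates, frameField]

/-- A vector field is differentiable if its inner products with differentiable vector fields
are. -/
theorem mdiffAt_of_inner [IsManifold I 1 M] [RiemannianBundle (fun x : M ↦ TangentSpace I x)]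
    [IsContMDiffRiemannianBundle I 1 E (fun x : M ↦ TangentSpace I x)]
    {Z : Π x : M, TangentSpace I x} {x : M}
    (h : ∀ X : Π x : M, TangentSpace I x, MDiffAt (T% X) x →
      MDiffAt (fun y ↦ inner ℝ (Z y) (X y)) x) : MDiffAt (T% Z) x := by
  set t := trivializationAt E (TangentSpace I) x with ht
  have hbase : x ∈ t.baseSet := FiberBundle.mem_baseSet_trivializationAt' x
  -- `g` is the metric in the local frame and `c` the covector of `Z`; the coordinates of `Z` are
  -- `g⁻¹ c`, and inversion is smooth at invertible maps.
  let g : M → E →L[ℝ] E →L[ℝ] ℝ := fun y ↦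
    ((innerSL ℝ : TangentSpace I y →L[ℝ] TangentSpace I y →L[ℝ] ℝ).bilinearComp
      (t.symmL ℝ y) (t.symmL ℝ y))
  have hg (y : M) (v w : E) : g y v w = inner ℝ (frameField I x v y) (frameField I x w y) := rfl
  let c : M → E →L[ℝ] ℝ := fun y ↦ (innerSL ℝ (Z y)).comp (t.symmL ℝ y)
  have hgd : MDiffAt g x := mdiffAt_clm fun v ↦ mdiffAt_clm fun w ↦
    show MDiffAt (fun y ↦ inner ℝ (frameField I x v y) (frameField I x w y)) x from
      MDifferentiableAt.inner_bundle (mdiffAt_frameField x v) (mdiffAt_frameField x w)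
  have hcd : MDiffAt c x := mdiffAt_clm fun w ↦ h _ (mdiffAt_frameField x w)
  have : CompleteSpace E := FiniteDimensional.complete ℝ E
  have hinj (y) (hy : y ∈ t.baseSet) : Function.Injective (g y) := by
    refine (injective_iff_map_eq_zero _).2 fun v hv ↦ ?_
    have h0 : inner ℝ (frameField I x v y) (frameField I x v y) = 0 := by
      rw [← hg, hv]
      rfl
    rw [inner_self_eq_zero] at h0
    have h1 : (t ⟨y, frameField I x v y⟩).2 = v := by
      rw [frameField, Trivialization.symmL_apply _ hy, Trivialization.apply_mk_symm _ hy]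
    rw [← h1, h0]
    exact (t.linear ℝ hy).map_zero
  have hinv (y) (hy : y ∈ t.baseSet) : (g y).IsInvertible := by
    have hfin : Module.finrank ℝ E = Module.finrank ℝ (E →L[ℝ] ℝ) := by
      rw [← (LinearMap.toContinuousLinearMap (𝕜 := ℝ) (E := E) (F' := ℝ)).finrank_eq,
        Module.finrank_linearMap, Module.finrank_self, mul_one]
    exact ⟨(LinearEquiv.ofInjectiveOfFinrankEq (g y : E →ₗ[ℝ] E →L[ℝ] ℝ) (hinj y hy)
      hfin).toContinuousLinearEquiv, rfl⟩
  have hinvd : MDiffAt (fun y ↦ (g y).inverse) x :=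
    ((hinv x hbase).contDiffAt_map_inverse (n := 1)).differentiableAt (by simp)
      |>.mdifferentiableAt.comp x hgd
  rw [mdifferentiableAt_section]
  refine (hinvd.clm_apply hcd).congr_of_eventuallyEq ?_
  filter_upwards [t.open_baseSet.mem_nhds hbase] with y hy
  have hz : frameField I x (t ⟨y, Z y⟩).2 y = Z y := by
    rw [frameField, Trivialization.symmL_apply _ hy]
    exact t.symm_apply_apply_mk hy (Z y)
  have hc : c y = g y (t ⟨y, Z y⟩).2 := by
    ext w
    rw [hg, hz]
    rfl
  rw [hc]
  exact ((hinv y hy).inverse_apply_self _).symm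

end Tangent
end SpinSubmersion

/-! ### Gradients, Hessians and covariant derivatives of one-forms -/

namespace SpinSubmersion

section Tangent

variable {E : Type*} [NormedAddCommGroup E] [NormedSpace ℝ E] [FiniteDimensional ℝ E]
  {H : Type*} [TopologicalSpace H] {I : ModelWithCorners ℝ E H} [I.Boundaryless]
  {M : Type*} [TopologicalSpace M] [ChartedSpace H M] [IsManifold I 2 M]
  [RiemannianBundle (fun x : M ↦ TangentSpace I x)]
  [IsContMDiffRiemannianBundle I 1 E (fun x : M ↦ TangentSpace I x)]

variable (I) in
/-- The gradient of a function. -/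
noncomputable def grad (u : M → ℝ) (x : M) : TangentSpace I x :=
  (InnerProductSpace.toDual ℝ (TangentSpace I x)).symm (d% u x)

theorem inner_grad (u : M → ℝ) (x : M) (v : TangentSpace I x) :
    inner ℝ (grad I u x) v = d% u x v :=
  InnerProductSpace.toDual_symm_apply

theorem mdiffAt_grad {u : M → ℝ} {x : M} (hu : ContMDiffAt I 𝓘(ℝ) 2 u x) :
    MDiffAt (T% (grad I u)) x :=
  mdiffAt_of_inner fun X hX ↦ by
    simp_rw [inner_grad]
    exact mdiffAt_mvfderiv_apply hu hX

/-- The Hessian of a function is symmetric. -/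
theorem inner_leviCivita_grad_comm {u : M → ℝ} {x : M} (hu : ContMDiffAt I 𝓘(ℝ) 2 u x)
    (v w : TangentSpace I x) :
    inner ℝ (leviCivita I M (grad I u) x v) w = inner ℝ (leviCivita I M (grad I u) x w) v := by
  have hv := FiberBundle.mdifferentiableAt_extend I E v
  have hw := FiberBundle.mdifferentiableAt_extend I E w
  have hg := mdiffAt_grad hu
  -- Differentiate `du(w)` along `v` and `du(v)` along `w`. The difference is `du([v, w])`, which
  -- cancels the terms `(grad u, ∇_v w - ∇_w v)` because the torsion vanishes.
  have h1 := leviCivita_metric hv hg hw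
  have h2 := leviCivita_metric hw hg hv
  have h3 := mvfderiv_mlieBracket hu hv hw
  rw [← leviCivita_torsion_free hv hw, map_sub] at h3
  simp only [inner_grad] at h1 h2
  simp only [FiberBundle.extend_apply_self] at h1 h2 h3
  linarith

/-- The exterior derivative of a one-form is the alternation of its covariant derivative. -/
theorem oneFormExtDeriv_eq_sub {α : Π x : M, TangentSpace I x →L[ℝ] ℝ} {x : M}
    (hα : OneFormDiffAt α x) (v w : TangentSpace I x) :
    oneFormExtDeriv α x v w =
      dualConnection (leviCivita I M) α x v w - dualConnection (leviCivita I M) α x w v := by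
  have hv := FiberBundle.mdifferentiableAt_extend I E v
  have hw := FiberBundle.mdifferentiableAt_extend I E w
  have h1 := oneFormExtDeriv_apply hα hv hw
  have h2 := dualConnection_apply (leviCivita I M) hα hv hw
  have h3 := dualConnection_apply (leviCivita I M) hα hw hv
  rw [← leviCivita_torsion_free hv hw, map_sub] at h1
  simp only [FiberBundle.extend_apply_self] at h1 h2 h3
  linarith

/-- The covariant derivative of a one-form of constant length is orthogonal to the form. -/
theorem dualConnection_of_norm_eq_one {α : Π x : M, TangentSpace I x →L[ℝ] ℝ} {x : M}
    (hα : OneFormDiffAt α x) {n : Π x : M, TangentSpace I x} (hn : ∀ y, innerSL ℝ (n y) = α y)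
    (h1 : ∀ y, inner ℝ (n y) (n y) = (1 : ℝ)) (v : TangentSpace I x) :
    dualConnection (leviCivita I M) α x v (n x) = 0 := by
  have hv := FiberBundle.mdifferentiableAt_extend I E v
  have hin (y : M) (w : TangentSpace I y) : α y w = inner ℝ (n y) w := by
    rw [← hn, innerSL_apply_apply]
  -- The field `n` is given only pointwise as the dual of `α`, and inherits differentiability from
  -- it.
  have hnd : MDiffAt (T% n) x := mdiffAt_of_inner fun X hX ↦ by
    simp_rw [← hin]
    exact hα.apply hX
  have h2 := dualConnection_apply (leviCivita I M) hα hv hnd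
  have h3 := leviCivita_metric hv hnd hnd
  simp only [hin, h1, mvfderiv_const, FiberBundle.extend_apply_self] at h2 h3
  rw [real_inner_comm] at h3
  rw [h2]
  simp only [ContinuousLinearMap.zero_apply] at h3 ⊢
  linarith

/-- The covariant derivative of a one-form that vanishes on a gradient field of constant length
along the dual direction. -/
theorem dualConnection_grad_grad {α : Π x : M, TangentSpace I x →L[ℝ] ℝ} {x : M}
    (hα : OneFormDiffAt α x) {n : TangentSpace I x} (hn : innerSL ℝ n = α x)
    {u : M → ℝ} (hu : ContMDiffAt I 𝓘(ℝ) 2 u x) (h0 : ∀ᶠ y in 𝓝 x, α y (grad I u y) = 0)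
    (h1 : d% (fun y ↦ inner ℝ (grad I u y) (grad I u y)) x n = 0) :
    dualConnection (leviCivita I M) α x (grad I u x) (grad I u x) = 0 := by
  have hg := mdiffAt_grad hu
  have hn' := FiberBundle.mdifferentiableAt_extend I E n
  have h2 := dualConnection_apply (leviCivita I M) hα hg hg
  have h3 := leviCivita_metric hn' hg hg
  have h4 : d% (fun y ↦ α y (grad I u y)) x = 0 := by
    rw [mvfderiv_congr h0, mvfderiv_const]
  -- Exchanges the directions: `(n, ∇_{grad u} grad u) = (∇_n grad u, grad u)`, half the derivative
  -- of `|grad u|²` along `n`.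
  have h5 := inner_leviCivita_grad_comm hu n (grad I u x)
  simp only [FiberBundle.extend_apply_self] at h3
  rw [h1, real_inner_comm (leviCivita I M (grad I u) x n)] at h3
  rw [h2, h4, ← hn, innerSL_apply_apply, real_inner_comm, ← h5]
  simp only [ContinuousLinearMap.zero_apply]
  linarith

end Tangent
end SpinSubmersion

/-! ### Differentiability of `*φ^*(vol_N)` -/

namespace SpinSubmersion

section LinearAlgebra

variable {V W : Type*} [NormedAddCommGroup V] [InnerProductSpace ℝ V] [FiniteDimensional ℝ V]
  [NormedAddCommGroup W] [InnerProductSpace ℝ W] [FiniteDimensional ℝ W]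

/-- The Hodge star of the pulled back area form is dual to a unit vector in the kernel. -/
theorem exists_unit_normal [Fact (Module.finrank ℝ V = 3)] [Fact (Module.finrank ℝ W = 2)]
    (o : Orientation ℝ V (Fin 3)) (oW : Orientation ℝ W (Fin 2)) {A : V →L[ℝ] W}
    (hA : ∀ w, A (ContinuousLinearMap.adjoint A w) = w) :
    ∃ n : V, innerSL ℝ n = hodgeStar o (oW.areaForm.compl₁₂ (A : V →ₗ[ℝ] W) (A : V →ₗ[ℝ] W)) ∧
      A n = 0 ∧ inner ℝ n n = (1 : ℝ) := by
  obtain ⟨e, he0, he1, h2, hvol⟩ :=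
    exists_adapted_basis o hA (oW.finOrthonormalBasis (by norm_num) Fact.out)
  refine ⟨e 2, (hodgeStar_pullback o oW hvol h2 ?_).symm, h2, by simp [e.inner_eq_ite]⟩
  rw [he0, he1, hA, hA]
  exact areaForm_finOrthonormalBasis oW

/-- For a positive frame the root is the area of the frame. Only inner products remain on the right,
so differentiability can be read off. -/
theorem areaForm_eq_div [Fact (Module.finrank ℝ W = 2)] (o : Orientation ℝ W (Fin 2)) {y z : W}
    (h : 0 < o.areaForm y z) (p q : W) : o.areaForm p q =
      (inner ℝ p y * inner ℝ q z - inner ℝ p z * inner ℝ q y) *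
        (√(inner ℝ y y * inner ℝ z z - inner ℝ y z * inner ℝ y z))⁻¹ := by
  have h1 : √(inner ℝ y y * inner ℝ z z - inner ℝ y z * inner ℝ y z) = o.areaForm y z := by
    rw [← Real.sqrt_sq h.le, sq, areaForm_mul_areaForm, real_inner_comm z y]
  rw [h1, ← areaForm_mul_areaForm, mul_inv_cancel_right₀ h.ne']

/-- Replaces the orthonormal basis in the definition of the star, chosen separately at every point,
by a frame that can vary smoothly. -/
theorem hodgeStar_eq_div [Fact (Module.finrank ℝ V = 3)] (o : Orientation ℝ V (Fin 3))
    {β : V →ₗ[ℝ] V →ₗ[ℝ] ℝ} (hβ : ∀ v, β v v = 0) {a b c : V} (h : 0 < o.volumeForm ![a, b, c])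
    (w : V) : hodgeStar o β w =
      (β a b * inner ℝ c w + β b c * inner ℝ a w + β c a * inner ℝ b w) *
        (√(inner ℝ a a * inner ℝ b b * inner ℝ c c + 2 * inner ℝ a b * inner ℝ b c * inner ℝ a c
          - inner ℝ a a * inner ℝ b c ^ 2 - inner ℝ b b * inner ℝ a c ^ 2
          - inner ℝ c c * inner ℝ a b ^ 2))⁻¹ := by
  rw [← volumeForm_sq o, Real.sqrt_sq h.le, ← hodgeStar_mul_volumeForm o hβ,
    mul_inv_cancel_right₀ h.ne']

theorem hodgeStar_pullback_eq_div [Fact (Module.finrank ℝ V = 3)] [Fact (Module.finrank ℝ W = 2)]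
    (o : Orientation ℝ V (Fin 3)) (oW : Orientation ℝ W (Fin 2)) (A : V →L[ℝ] W) {a b c : V}
    (h : 0 < o.volumeForm ![a, b, c]) (w : V) :
    hodgeStar o (oW.areaForm.compl₁₂ (A : V →ₗ[ℝ] W) (A : V →ₗ[ℝ] W)) w =
      (oW.areaForm (A a) (A b) * inner ℝ c w + oW.areaForm (A b) (A c) * inner ℝ a w
        + oW.areaForm (A c) (A a) * inner ℝ b w) *
        (√(inner ℝ a a * inner ℝ b b * inner ℝ c c + 2 * inner ℝ a b * inner ℝ b c * inner ℝ a c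
          - inner ℝ a a * inner ℝ b c ^ 2 - inner ℝ b b * inner ℝ a c ^ 2
          - inner ℝ c c * inner ℝ a b ^ 2))⁻¹ :=
  hodgeStar_eq_div o (β := oW.areaForm.compl₁₂ (A : V →ₗ[ℝ] W) (A : V →ₗ[ℝ] W))
    (fun _ ↦ oW.areaForm_apply_self _) h w

end LinearAlgebra

section Differentiability

variable {E : Type*} [NormedAddCommGroup E] [NormedSpace ℝ E]
  {H : Type*} [TopologicalSpace H] {I : ModelWithCorners ℝ E H}
  {M : Type*} [TopologicalSpace M] [ChartedSpace H M]

/-- The vector field `X` is differentiable at `x`. -/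
abbrev VectorFieldDiffAt [IsManifold I 1 M] (X : Π x : M, TangentSpace I x) (x : M) : Prop :=
  MDiffAt (T% X) x

theorem mdiffAt_sqrt_inv {f : M → ℝ} {x : M} (hf : MDiffAt f x) (h : √(f x) ≠ 0) :
    MDiffAt (fun y ↦ (√(f y))⁻¹) x := by
  have h1 : f x ≠ 0 := fun h0 ↦ h (by rw [h0, Real.sqrt_zero])
  exact (((differentiableAt_id.sqrt h1).inv h).mdifferentiableAt).comp x hf

end Differentiability

section Submersion

variable {M : Type*} [TopologicalSpace M] [ChartedSpace (EuclideanSpace ℝ (Fin 3)) M]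
  [IsManifold (𝓡 3) ∞ M] [RiemannianBundle (fun x : M ↦ TangentSpace (𝓡 3) x)]
  [IsContMDiffRiemannianBundle (𝓡 3) ∞ (EuclideanSpace ℝ (Fin 3))
    (fun x : M ↦ TangentSpace (𝓡 3) x)]
  {N : Type*} [TopologicalSpace N] [ChartedSpace (EuclideanSpace ℝ (Fin 2)) N]
  [IsManifold (𝓡 2) ∞ N] [RiemannianBundle (fun x : N ↦ TangentSpace (𝓡 2) x)]
  [IsContMDiffRiemannianBundle (𝓡 2) ∞ (EuclideanSpace ℝ (Fin 2))
    (fun x : N ↦ TangentSpace (𝓡 2) x)]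
  {oM : Π x : M, Orientation ℝ (TangentSpace (𝓡 3) x) (Fin 3)}
  {oN : Π x : N, Orientation ℝ (TangentSpace (𝓡 2) x) (Fin 2)}
  {φ : C^∞⟮𝓡 3, M; 𝓡 2, N⟯}

/-- The field along `φ` is the tangent map composed with `X`; the tangent map loses one order of
smoothness. -/
theorem mdiffAt_pushforward {X : Π x : M, TangentSpace (𝓡 3) x} {x : M} (hX : VectorFieldDiffAt X x) :
    MDifferentiableAt (𝓡 3) (𝓡 2).tangent
      (fun y ↦ (⟨φ y, mfderiv (𝓡 3) (𝓡 2) φ y (X y)⟩ : TangentBundle (𝓡 2) N)) x := by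
  have h := (φ.contMDiff.contMDiff_tangentMap (m := 1)
    (by
      have h : ((2 : ℕ∞) : WithTop ℕ∞) ≤ ∞ := by exact_mod_cast le_top
      simpa [one_add_one_eq_two] using h)).mdifferentiable
    one_ne_zero (⟨x, X x⟩ : TangentBundle (𝓡 3) M)
  exact h.comp x hX

theorem mdiffAt_inner_pushforward {X : Π x : M, TangentSpace (𝓡 3) x} {x : M}
    (hX : VectorFieldDiffAt X x) {Y : Π x : N, TangentSpace (𝓡 2) x} (hY : VectorFieldDiffAt Y (φ x)) :
    MDifferentiableAt (𝓡 3) 𝓘(ℝ) (fun y ↦ inner ℝ (mfderiv (𝓡 3) (𝓡 2) φ y (X y)) (Y (φ y))) x :=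
  MDifferentiableAt.inner_bundle (mdiffAt_pushforward hX)
    (hY.comp x (φ.contMDiff.mdifferentiable (by simp) x))

theorem mdiffAt_areaForm_pushforward (hoN : IsSmoothOrientation oN)
    {X Z : Π x : M, TangentSpace (𝓡 3) x} {x : M}
    (hX : VectorFieldDiffAt X x) (hZ : VectorFieldDiffAt Z x) :
    MDifferentiableAt (𝓡 3) 𝓘(ℝ) (fun y ↦ (oN (φ y)).areaForm (mfderiv (𝓡 3) (𝓡 2) φ y (X y))
      (mfderiv (𝓡 3) (𝓡 2) φ y (Z y))) x := by
  obtain ⟨Y, hY, hpos⟩ := hoN (φ x)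
  have hYd (i) : VectorFieldDiffAt (Y i) (φ x) := (hY i).mdifferentiableAt (by simp)
  have hφ : MDifferentiableAt (𝓡 3) (𝓡 2) φ x := φ.contMDiff.mdifferentiable (by simp) x
  have hYY (i j) : MDifferentiableAt (𝓡 3) 𝓘(ℝ) (fun y ↦ inner ℝ (Y i (φ y)) (Y j (φ y))) x :=
    (inner_diffAt (hYd i) (hYd j)).comp x hφ
  have hpos' : ∀ᶠ y in 𝓝 x, 0 < (oN (φ y)).areaForm (Y 0 (φ y)) (Y 1 (φ y)) := by
    filter_upwards [φ.contMDiff.continuous.continuousAt.eventually hpos] with y hy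
    rw [Orientation.areaForm_to_volumeForm]
    convert hy using 2
    ext i : 1
    fin_cases i <;> rfl
  refine MDifferentiableAt.congr_of_eventuallyEq ?_
    (hpos'.mono fun y hy ↦ areaForm_eq_div (oN (φ y)) hy _ _)
  refine (((mdiffAt_inner_pushforward hX (hYd 0)).mul (mdiffAt_inner_pushforward hZ (hYd 1))).sub
    ((mdiffAt_inner_pushforward hX (hYd 1)).mul (mdiffAt_inner_pushforward hZ (hYd 0)))).mul
    (mdiffAt_sqrt_inv (((hYY 0 0).mul (hYY 1 1)).sub ((hYY 0 1).mul (hYY 0 1))) ?_)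
  -- If the root vanished, the quotient formula would give the frame itself zero area.
  intro h0
  have h1 := hpos'.self_of_nhds
  have h2 := areaForm_eq_div (oN (φ x)) h1 (Y 0 (φ x)) (Y 1 (φ x))
  change √(_ * _ - _ * _) = 0 at h0
  rw [h0, inv_zero, mul_zero] at h2
  exact h1.ne' h2

/-- The one-form `*φ^*(vol_N)` is differentiable. -/
theorem oneFormDiffAt_fiberForm (hoM : IsSmoothOrientation oM) (hoN : IsSmoothOrientation oN)
    (x : M) : OneFormDiffAt (fiberForm φ oM oN) x := by
  refine OneFormDiffAt.of_apply fun Z hZ ↦ ?_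
  obtain ⟨X, hX, hpos⟩ := hoM x
  have hXd (i) : VectorFieldDiffAt (X i) x := (hX i).mdifferentiableAt (by simp)
  have hXX (i j) : MDifferentiableAt (𝓡 3) 𝓘(ℝ) (fun y ↦ inner ℝ (X i y) (X j y)) x := inner_diffAt (hXd i) (hXd j)
  have hXZ (i) : MDifferentiableAt (𝓡 3) 𝓘(ℝ) (fun y ↦ inner ℝ (X i y) (Z y)) x := inner_diffAt (hXd i) hZ
  have hA (i j) := mdiffAt_areaForm_pushforward (φ := φ) hoN (hXd i) (hXd j)
  have hpos' : ∀ᶠ y in 𝓝 x, 0 < (oM y).volumeForm ![X 0 y, X 1 y, X 2 y] := by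
    filter_upwards [hpos] with y hy
    convert hy using 2
    ext i : 1
    fin_cases i <;> rfl
  -- The quotient formula holds in a whole neighbourhood because the frame stays positive there.
  refine MDifferentiableAt.congr_of_eventuallyEq ?_
    (hpos'.mono fun y hy ↦ hodgeStar_pullback_eq_div (V := TangentSpace (𝓡 3) y)
      (W := TangentSpace (𝓡 2) (φ y)) (oM y) (oN (φ y)) (mfderiv (𝓡 3) (𝓡 2) φ y) hy (Z y))
  refine ((((hA 0 1).mul (hXZ 2)).add ((hA 1 2).mul (hXZ 0))).add ((hA 2 0).mul (hXZ 1))).mul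
    (mdiffAt_sqrt_inv ?_ ?_)
  · simp only [sq, two_mul]
    exact (((((((hXX 0 0).mul (hXX 1 1)).mul (hXX 2 2)).add
      ((((hXX 0 1).add (hXX 0 1)).mul (hXX 1 2)).mul (hXX 0 2))).sub
      ((hXX 0 0).mul ((hXX 1 2).mul (hXX 1 2)))).sub
      ((hXX 1 1).mul ((hXX 0 2).mul (hXX 0 2)))).sub
      ((hXX 2 2).mul ((hXX 0 1).mul (hXX 0 1))))
  · rw [← volumeForm_sq (oM x), Real.sqrt_sq hpos'.self_of_nhds.le]
    exact hpos'.self_of_nhds.ne'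

end Submersion
end SpinSubmersion

/-! ### Horizontal lifts and the covariant derivative of `*φ^*(vol_N)` -/

namespace SpinSubmersion

section Submersion

variable {M : Type*} [TopologicalSpace M] [ChartedSpace (EuclideanSpace ℝ (Fin 3)) M]
  [IsManifold (𝓡 3) ∞ M] [RiemannianBundle (fun x : M ↦ TangentSpace (𝓡 3) x)]
  [IsContMDiffRiemannianBundle (𝓡 3) ∞ (EuclideanSpace ℝ (Fin 3))
    (fun x : M ↦ TangentSpace (𝓡 3) x)]
  {N : Type*} [TopologicalSpace N] [ChartedSpace (EuclideanSpace ℝ (Fin 2)) N]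
  [IsManifold (𝓡 2) ∞ N] [RiemannianBundle (fun x : N ↦ TangentSpace (𝓡 2) x)]
  [IsContMDiffRiemannianBundle (𝓡 2) ∞ (EuclideanSpace ℝ (Fin 2))
    (fun x : N ↦ TangentSpace (𝓡 2) x)]
  {oM : Π x : M, Orientation ℝ (TangentSpace (𝓡 3) x) (Fin 3)}
  {oN : Π x : N, Orientation ℝ (TangentSpace (𝓡 2) x) (Fin 2)}
  {φ : C^∞⟮𝓡 3, M; 𝓡 2, N⟯}

/-- The horizontal lift of a tangent vector. -/
noncomputable def horizontalLift (φ : C^∞⟮𝓡 3, M; 𝓡 2, N⟯) (x : M) :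
    TangentSpace (𝓡 2) (φ x) →L[ℝ] TangentSpace (𝓡 3) x :=
  ContinuousLinearMap.adjoint
    (mfderiv (𝓡 3) (𝓡 2) φ x : TangentSpace (𝓡 3) x →L[ℝ] TangentSpace (𝓡 2) (φ x))

theorem inner_horizontalLift_left (x : M) (w : TangentSpace (𝓡 2) (φ x))
    (v : TangentSpace (𝓡 3) x) :
    inner ℝ (horizontalLift φ x w) v = inner ℝ w (mfderiv (𝓡 3) (𝓡 2) φ x v) :=
  ContinuousLinearMap.adjoint_inner_left _ _ _

theorem IsRiemannianSubmersion.mfderiv_horizontalLift (hφ : IsRiemannianSubmersion φ) (x : M)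
    (w : TangentSpace (𝓡 2) (φ x)) : mfderiv (𝓡 3) (𝓡 2) φ x (horizontalLift φ x w) = w :=
  comp_adjoint_of_isometric (V := TangentSpace (𝓡 3) x) (W := TangentSpace (𝓡 2) (φ x))
    (hφ x).1 (hφ x).2 w

theorem exists_fiberForm_dual (oM : Π x : M, Orientation ℝ (TangentSpace (𝓡 3) x) (Fin 3))
    (oN : Π x : N, Orientation ℝ (TangentSpace (𝓡 2) x) (Fin 2)) (hφ : IsRiemannianSubmersion φ) :
    ∃ n : Π x : M, TangentSpace (𝓡 3) x, ∀ x, innerSL ℝ (n x) = fiberForm φ oM oN x ∧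
      mfderiv (𝓡 3) (𝓡 2) φ x (n x) = 0 ∧ inner ℝ (n x) (n x) = (1 : ℝ) := by
  choose n hn using fun x ↦ exists_unit_normal (V := TangentSpace (𝓡 3) x)
    (W := TangentSpace (𝓡 2) (φ x)) (oM x) (oN (φ x)) (hφ.mfderiv_horizontalLift x)
  exact ⟨n, hn⟩

/-- Every tangent vector of `N` is the gradient of a function. -/
theorem exists_grad_eq (q : N) (w : TangentSpace (𝓡 2) q) :
    ∃ g : N → ℝ, ContMDiffAt (𝓡 2) 𝓘(ℝ) 2 g q ∧ grad (𝓡 2) g q = w := by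
  -- The function is linear in the chart at `q`. The chart has identity differential at `q`, so the
  -- differential of the function there is pairing with `w`.
  let ℓ : EuclideanSpace ℝ (Fin 2) →L[ℝ] ℝ := (innerSL ℝ w : TangentSpace (𝓡 2) q →L[ℝ] ℝ)
  have hc : ContMDiffAt (𝓡 2) 𝓘(ℝ, EuclideanSpace ℝ (Fin 2)) 2 (extChartAt (𝓡 2) q) q :=
    contMDiffAt_extChartAt
  refine ⟨ℓ ∘ extChartAt (𝓡 2) q, ℓ.contDiff.contMDiff.contMDiffAt.comp q hc, ?_⟩
  refine ext_inner_right ℝ fun v ↦ ?_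
  rw [inner_grad]
  have h1 : mfderiv (𝓡 2) 𝓘(ℝ) (ℓ ∘ extChartAt (𝓡 2) q) q v =
      mfderiv 𝓘(ℝ, EuclideanSpace ℝ (Fin 2)) 𝓘(ℝ) ℓ (extChartAt (𝓡 2) q q)
        (mfderiv (𝓡 2) 𝓘(ℝ, EuclideanSpace ℝ (Fin 2)) (extChartAt (𝓡 2) q) q v) :=
    mfderiv_comp_apply q ℓ.mdifferentiableAt (hc.mdifferentiableAt (by simp)) v
  rw [mfderiv_extChartAt_self, mfderiv_eq_fderiv, ContinuousLinearMap.fderiv] at h1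
  exact h1

/-- The gradient of a pulled back function is the horizontal lift of the gradient. -/
theorem eventually_grad_comp {g : N → ℝ} {x : M} (hg : ContMDiffAt (𝓡 2) 𝓘(ℝ) 2 g (φ x)) :
    ∀ᶠ y in 𝓝 x, grad (𝓡 3) (g ∘ φ) y = horizontalLift φ y (grad (𝓡 2) g (φ y)) := by
  filter_upwards [φ.contMDiff.continuous.continuousAt.eventually
    ((contMDiffAt_iff_contMDiffAt_nhds (by simp)).1 hg)] with y hy
  refine ext_inner_right ℝ fun v ↦ ?_
  rw [inner_grad, inner_horizontalLift_left, inner_grad]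
  exact mvfderiv_comp_apply y (hy.mdifferentiableAt (by simp))
    (φ.contMDiff.mdifferentiable (by simp) y) v

/-- The covariant derivative of `*φ^*(vol_N)` is alternating on horizontal vectors. -/
theorem dualConnection_fiberForm_horizontalLift (hoM : IsSmoothOrientation oM)
    (hoN : IsSmoothOrientation oN) (hφ : IsRiemannianSubmersion φ) (x : M)
    (w : TangentSpace (𝓡 2) (φ x)) :
    dualConnection (leviCivita (𝓡 3) M) (fiberForm φ oM oN) x (horizontalLift φ x w)
      (horizontalLift φ x w) = 0 := by
  obtain ⟨n, hn⟩ := exists_fiberForm_dual oM oN hφ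
  -- Only the value at `x` matters, so the horizontal lift of `w` may be extended as the gradient of
  -- `g ∘ φ`.
  obtain ⟨g, hg, rfl⟩ := exists_grad_eq (φ x) w
  have hgrad := eventually_grad_comp (φ := φ) hg
  have hφx : MDifferentiableAt (𝓡 3) (𝓡 2) φ x := φ.contMDiff.mdifferentiable (by simp) x
  rw [← hgrad.self_of_nhds]
  have htwo : ((2 : ℕ∞) : WithTop ℕ∞) ≤ ∞ := by exact_mod_cast le_top
  refine dualConnection_grad_grad (oneFormDiffAt_fiberForm hoM hoN x) (hn x).1
    (hg.comp x (φ.contMDiff.contMDiffAt.of_le (by simpa using htwo))) ?_ ?_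
  · filter_upwards [hgrad] with y hy
    rw [hy, ← (hn y).1, innerSL_apply_apply, real_inner_comm, inner_horizontalLift_left,
      (hn y).2.1, inner_zero_right]
  -- Horizontal lifting preserves lengths, so `|grad (g ∘ φ)|²` comes from `N` and the vertical
  -- vector `n x` does not see it.
  · have h1 : (fun y ↦ inner ℝ (grad (𝓡 3) (g ∘ φ) y) (grad (𝓡 3) (g ∘ φ) y)) =ᶠ[𝓝 x]
        (fun q ↦ inner ℝ (grad (𝓡 2) g q) (grad (𝓡 2) g q)) ∘ φ := by
      filter_upwards [hgrad] with y hy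
      rw [hy, inner_horizontalLift_left, hφ.mfderiv_horizontalLift]
      rfl
    rw [mvfderiv_congr h1]
    have hG := mdiffAt_grad hg
    refine (mvfderiv_comp_apply x (inner_diffAt hG hG) hφx (n x)).trans ?_
    rw [(hn x).2.1, map_zero]

end Submersion
end SpinSubmersion

/-! ### The formula for the lifted Dirac operator -/

theorem mainTheorem6
    {M : Type*} [TopologicalSpace M] [ChartedSpace (EuclideanSpace ℝ (Fin 3)) M]
    [IsManifold (𝓡 3) ∞ M] [RiemannianBundle (fun x : M ↦ TangentSpace (𝓡 3) x)]
    [IsContMDiffRiemannianBundle (𝓡 3) ∞ (EuclideanSpace ℝ (Fin 3))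
      (fun x : M ↦ TangentSpace (𝓡 3) x)]
    {N : Type*} [TopologicalSpace N] [ChartedSpace (EuclideanSpace ℝ (Fin 2)) N]
    [IsManifold (𝓡 2) ∞ N] [RiemannianBundle (fun x : N ↦ TangentSpace (𝓡 2) x)]
    [IsContMDiffRiemannianBundle (𝓡 2) ∞ (EuclideanSpace ℝ (Fin 2))
      (fun x : N ↦ TangentSpace (𝓡 2) x)]
    (oM : Π x : M, Orientation ℝ (TangentSpace (𝓡 3) x) (Fin 3))
    (hoM : SpinSubmersion.IsSmoothOrientation oM)
    (oN : Π x : N, Orientation ℝ (TangentSpace (𝓡 2) x) (Fin 2))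
    (hoN : SpinSubmersion.IsSmoothOrientation oN)
    (φ : C^∞⟮𝓡 3, M; 𝓡 2, N⟯) (hφ : SpinSubmersion.IsRiemannianSubmersion φ)
    {V : N → Type*} [∀ x, NormedAddCommGroup (V x)] [∀ x, InnerProductSpace ℂ (V x)]
    [TopologicalSpace (TotalSpace (EuclideanSpace ℂ (Fin 2)) V)]
    [FiberBundle (EuclideanSpace ℂ (Fin 2)) V]
    [VectorBundle ℂ (EuclideanSpace ℂ (Fin 2)) V] [VectorBundle ℝ (EuclideanSpace ℂ (Fin 2)) V]
    [ContMDiffVectorBundle ∞ (EuclideanSpace ℂ (Fin 2)) V (𝓡 2)]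
    (hV : SpinSubmersion.IsSmoothHermitian (𝓡 2) (EuclideanSpace ℂ (Fin 2)) V)
    (σ : Π x : N, (TangentSpace (𝓡 2) x →L[ℝ] ℝ) →ₗ[ℝ] Module.End ℂ (V x))
    (hσ : SpinSubmersion.IsCliffordMultiplication (F := EuclideanSpace ℂ (Fin 2)) σ)
    (D : CovariantDerivative (𝓡 2) (EuclideanSpace ℂ (Fin 2)) V) (hD : SpinSubmersion.IsSpincConnection σ D)
    (ξ : Π x : N, V x) 
    (hξ : ContMDiff (𝓡 2) ((𝓡 2).prod 𝓘(ℝ, EuclideanSpace ℂ (Fin 2))) ∞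
      fun y ↦ TotalSpace.mk' (EuclideanSpace ℂ (Fin 2)) y (ξ y)) (x : M) :
    let ν := SpinSubmersion.fiberForm φ oM oN
    let starDν := SpinSubmersion.hodgeExtDeriv oM ν
    let σM := SpinSubmersion.liftedClifford φ oM oN σ
    SpinSubmersion.dirac (V := φ *ᵖ V) (fun x α ↦ σM x α) (SpinSubmersion.liftedConnection φ oM oN σ D) (fun y ↦ ξ (φ y)) x =
      SpinSubmersion.dirac (fun x α ↦ σ x α) D ξ (φ x) +
        (1 / 2 : ℂ) • σM x (starDν x - (1 / 2 * SpinSubmersion.coInner (ν x) (starDν x)) • ν x)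
          (σM x (ν x) (ξ (φ x))) := by
  intro ν starDν σM
  obtain ⟨n, hn⟩ := SpinSubmersion.exists_fiberForm_dual oM oN hφ
  have hν : SpinSubmersion.OneFormDiffAt ν x :=
    SpinSubmersion.oneFormDiffAt_fiberForm hoM hoN x
  have hfin : FiniteDimensional ℝ (V (φ x)) :=
    VectorBundle.finiteDimensional ℝ (EuclideanSpace ℂ (Fin 2)) V (φ x)
  have hrank : Module.finrank ℂ (V (φ x)) = 2 := by
    have e := (trivializationAt (EuclideanSpace ℂ (Fin 2)) V (φ x)).continuousLinearEquivAt ℂ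
      (φ x) (FiberBundle.mem_baseSet_trivializationAt' (φ x))
    rw [e.toLinearEquiv.finrank_eq, finrank_euclideanSpace_fin]
  have key := SpinSubmersion.sum_lift_eq (V := TangentSpace (𝓡 3) x)
    (W := TangentSpace (𝓡 2) (φ x)) hrank (oM x) (oN (φ x)) (hσ.trace_eq_zero (φ x))
    (hσ.isometry (φ x)) (hφ.mfderiv_horizontalLift x) (ν := ν x) rfl
    (B := SpinSubmersion.dualConnection (SpinSubmersion.leviCivita (𝓡 3) M) ν x)
    (dν := SpinSubmersion.oneFormExtDeriv ν x)
    (SpinSubmersion.oneFormExtDeriv_eq_sub hν)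
    -- A vector is determined by its covector, so `m` is the value at `x` of the unit field `n` to
    -- which the constant-length argument applies.
    (fun m v hm ↦ by
      have h : m = n x := by
        refine ext_inner_right ℝ fun v ↦ ?_
        rw [← innerSL_apply_apply ℝ m, ← innerSL_apply_apply ℝ (n x), hm, (hn x).1]
      rw [h]
      exact SpinSubmersion.dualConnection_of_norm_eq_one hν (fun y ↦ (hn y).1)
        (fun y ↦ (hn y).2.2) v)
    (SpinSubmersion.dualConnection_fiberForm_horizontalLift hoM hoN hφ x)
    (D ξ (φ x)) (ξ (φ x)) (stdOrthonormalBasis ℝ (TangentSpace (𝓡 3) x))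
    (stdOrthonormalBasis ℝ (TangentSpace (𝓡 2) (φ x)))
  -- Identifies the first order term `D ξ ∘ φ_*` of the pointwise identity with the induced
  -- connection on `ξ ∘ φ`.
  have hchain (v : TangentSpace (𝓡 3) x) :=
    SpinSubmersion.inducedConnection_comp φ D (hξ.mdifferentiableAt (x := φ x) (by simp)) v
  simp only [← hchain] at key
  exact key
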